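/- Let $G$ be a finite graph (loops and multiple edges allowed) with $n$ vertices and $m$ edges. Order the vertices and the edges, and let $R=\mathbb{Q}[x_1,\dots,x_n]$, bigraded with $\mathbb{Q}$ in bidegree $(0,0)$ and every $x_i$ in bidegree $(0,1)$; $R\{a,b\}$ denotes the free module of rank one generated in bidegree $(a,b)$. To an edge $e$ with ends the $i$-th and $j$-th vertices assign the complex of complexes $\mathcal{D}_e$ whose row in degree $-1$ is $0\to R\{-1,2\}\xrightarrow{x_i-x_j}R\{0,1\}\to 0$, whose row in degree $0$ is $0\to R\{-1,1\}\xrightarrow{0}R\to 0$, and whose chain map from the row $-1$ to the row $0$ is $x_i-x_j$ on the left terms and $0$ on the right terms. To every vertex assign the complex $0\to R\{-1,1\}\xrightarrow{0}R\to0$, placed in row $0$. Tensor over $R$ all the $\mathcal{D}_e$ and all the vertex complexes. For every $j$ let $H^j(G)$ be the (total) cohomology of the horizontal complex in row $j$, a bigraded $R$-module. With the maps induced by the vertical differential, the $H^j(G)$ form a complex $\mathcal{D}(G)$ of bigraded $R$-modules (a triply graded complex). (1) The homotopy class of $\mathcal{D}(G)$ is an invariant of $G$: if $G'\cong G$, then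 for all choices made in the two constructions (orderings of the vertices, of the edges, and of the two ends of each edge), $\mathcal{D}(G)$ and $\mathcal{D}(G')$ are homotopy equivalent as complexes of bigraded $R$-modules, after the variables of $R$ have been permuted according to the isomorphism and the orderings of the vertices. (2) $H^j(G)=0$ unless $-m\le j\le 0$, every $H^j(G)$ has finite-dimensional homogeneous parts $H^j(G)_{a,b}$, and the bigraded Euler characteristic of $\mathcal{D}(G)$ is the reparametrized dichromatic polynomial: $$\sum_{j}(-1)^j\sum_{a,b}\dim_{\mathbb{Q}}\big(H^j(G)_{a,b}\big)\,t^aq^b \;=\; D_G(t,q)\;=\;(1+t^{-1}q)^m\,P_G\Big(q,\frac{1+t^{-1}q}{1-q}\Big),$$ as power series in $q$ over $\mathbb{Z}[t,t^{-1}]$, where $\frac1{1-q}=\sum_{i\ge0}q^i$ and $P_G(q,v)$ is the dichromatic polynomial, given by $P_G=P_{G-e}-q\,P_{G/e}$ for every edge $e$ and $P_{N_k}=v^k$ for the graph $N_k$ with $k$ vertices and no edges; equivalently $P_G(q,v)=\sum_{s\subseteq E(G)}(-1)^{|s|}q^{|s|}v^{k(s)}$, with $k(s)$ the number of connected components of the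 spanning subgraph with edge set $s$. -/

import Mathlib

open scoped Kronecker LaurentPolynomial Graph
open CategoryTheory

noncomputable section

namespace KoszulGraph

/-! ### The ring `R = ℚ[x₁, …, xₙ]` and double complexes of free bigraded `R`-modules -/

/-- The polynomial ring `R = ℚ[x₁, …, xₙ]`; every `xᵢ` has bidegree `(0, 1)`. -/
abbrev PolyRing (n : ℕ) : Type := MvPolynomial (Fin n) ℚ

/-- For two finite bases whose elements carry a row, a `t`-degree and a `q`-degree (here the same
basis for source and target), the matrix `A` (`A i j` is the coefficient at the target element `i`
of the image of the source element `j`) raises the row by `r`, raises the `t`-degree by `t`, and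
preserves the `q`-degree, where a polynomial entry of degree `d` contributes `d`. -/
def HasDegree {n : ℕ} {ι : Type} (row tdeg qdeg : ι → ℤ) (r t : ℤ)
    (A : Matrix ι ι (PolyRing n)) : Prop :=
  ∀ i j, A i j ≠ 0 → row i = row j + r ∧ tdeg i = tdeg j + t ∧
    ∃ d : ℕ, (A i j).IsHomogeneous d ∧ qdeg j = qdeg i + d

/-- A complex of complexes of finitely generated free bigraded `R`-modules with chosen homogeneous
bases. The basis element `i` sits in the horizontal complex number `row i` and has bidegree
`(tdeg i, qdeg i)`. The horizontal differential `hor` preserves the row and raises the `t`-degree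
by one: in all complexes considered here the `t`-degree is the position in the horizontal complex.
The vertical differential `vert` goes from a row to the next one and preserves the bidegree.
Both differentials have square zero and they commute with each other. -/
structure FreeBicomplex (n : ℕ) where
  ι : Type
  [fintype : Fintype ι]
  [decEq : DecidableEq ι]
  row : ι → ℤ
  tdeg : ι → ℤ
  qdeg : ι → ℤ
  hor : Matrix ι ι (PolyRing n)
  vert : Matrix ι ι (PolyRing n)
  hor_deg : HasDegree row tdeg qdeg 0 1 hor
  vert_deg : HasDegree row tdeg qdeg 1 0 vert
  hor_hor : hor * hor = 0
  vert_vert : vert * vert = 0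
  hor_vert : hor * vert = vert * hor

attribute [instance] FreeBicomplex.fintype FreeBicomplex.decEq

namespace FreeBicomplex

variable {n : ℕ}

/-! ### Tensor products -/

/-- The diagonal matrix of the Koszul signs `(-1) ^ deg i`. -/
def sgn (n : ℕ) {ι : Type} [DecidableEq ι] (deg : ι → ℤ) : Matrix ι ι (PolyRing n) :=
  Matrix.diagonal fun i => ((Int.negOnePow (deg i) : ℤ) : PolyRing n)

theorem mul_sgn_of_odd {ι : Type} [Fintype ι] [DecidableEq ι] (deg : ι → ℤ)
    (A : Matrix ι ι (PolyRing n)) (hA : ∀ i j, A i j ≠ 0 → deg i = deg j + 1) :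
    A * sgn n deg = - (sgn n deg * A) := by
  ext1 i j
  rw [sgn, Matrix.mul_diagonal, Matrix.neg_apply, Matrix.diagonal_mul]
  by_cases h : A i j = 0
  · simp [h]
  · rw [hA i j h, Int.negOnePow_succ]
    push_cast
    ring

theorem mul_sgn_of_even {ι : Type} [Fintype ι] [DecidableEq ι] (deg : ι → ℤ)
    (A : Matrix ι ι (PolyRing n)) (hA : ∀ i j, A i j ≠ 0 → deg i = deg j) :
    A * sgn n deg = sgn n deg * A := by
  ext1 i j
  rw [sgn, Matrix.mul_diagonal, Matrix.diagonal_mul]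
  by_cases h : A i j = 0
  · simp [h]
  · rw [hA i j h]
    ring

theorem sgn_comm {ι : Type} [Fintype ι] [DecidableEq ι] (a b : ι → ℤ) :
    sgn n a * sgn n b = sgn n b * sgn n a := by
  simp only [sgn, Matrix.diagonal_mul_diagonal, mul_comm]

theorem tensor_sq {ι κ : Type} [Fintype ι] [DecidableEq ι] [Fintype κ] [DecidableEq κ]
    (deg : ι → ℤ) (A : Matrix ι ι (PolyRing n)) (B : Matrix κ κ (PolyRing n))
    (hA : ∀ i j, A i j ≠ 0 → deg i = deg j + 1) (hAA : A * A = 0) (hBB : B * B = 0) :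
    (A ⊗ₖ (1 : Matrix κ κ (PolyRing n)) + sgn n deg ⊗ₖ B) *
      (A ⊗ₖ (1 : Matrix κ κ (PolyRing n)) + sgn n deg ⊗ₖ B) = 0 := by
  simp only [add_mul, mul_add, ← Matrix.mul_kronecker_mul, hAA, hBB, mul_one, one_mul,
    mul_sgn_of_odd deg A hA]
  ext1 i j
  simp [Matrix.kroneckerMap_apply]

theorem tensor_hasDegree {ι κ : Type} [DecidableEq ι] [DecidableEq κ]
    {row tdeg qdeg : ι → ℤ} {row' tdeg' qdeg' : κ → ℤ} {r t : ℤ} (deg : ι → ℤ)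
    {A : Matrix ι ι (PolyRing n)} {B : Matrix κ κ (PolyRing n)}
    (hA : HasDegree row tdeg qdeg r t A) (hB : HasDegree row' tdeg' qdeg' r t B) :
    HasDegree (fun i : ι × κ => row i.1 + row' i.2) (fun i => tdeg i.1 + tdeg' i.2)
      (fun i => qdeg i.1 + qdeg' i.2) r t
      (A ⊗ₖ (1 : Matrix κ κ (PolyRing n)) + sgn n deg ⊗ₖ B) := by
  rintro ⟨i, k⟩ ⟨j, l⟩ h
  have e1 : (A ⊗ₖ (1 : Matrix κ κ (PolyRing n))) (i, k) (j, l) = if k = l then A i j else 0 := by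
    simp only [Matrix.kroneckerMap_apply, Matrix.one_apply]
    split_ifs <;> simp
  have e2 : (sgn n deg ⊗ₖ B) (i, k) (j, l) =
      if i = j then MvPolynomial.C ((Int.negOnePow (deg i) : ℤ) : ℚ) * B k l else 0 := by
    simp only [Matrix.kroneckerMap_apply, sgn, Matrix.diagonal_apply]
    split_ifs <;> simp
  rw [Matrix.add_apply, e1, e2] at h ⊢
  have key : ∀ p p' : PolyRing n, p + p' ≠ 0 →
      (p ≠ 0 → row i + row' k = row j + row' l + r ∧ tdeg i + tdeg' k = tdeg j + tdeg' l + t ∧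
        ∃ d : ℕ, p.IsHomogeneous d ∧ qdeg j + qdeg' l = qdeg i + qdeg' k + d) →
      (p' ≠ 0 → row i + row' k = row j + row' l + r ∧ tdeg i + tdeg' k = tdeg j + tdeg' l + t ∧
        ∃ d : ℕ, p'.IsHomogeneous d ∧ qdeg j + qdeg' l = qdeg i + qdeg' k + d) →
      row i + row' k = row j + row' l + r ∧ tdeg i + tdeg' k = tdeg j + tdeg' l + t ∧
        ∃ d : ℕ, (p + p').IsHomogeneous d ∧ qdeg j + qdeg' l = qdeg i + qdeg' k + d := by
    intro p p' hpp hp hp'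
    by_cases h0 : p = 0
    · subst h0
      rw [zero_add] at hpp ⊢
      exact hp' hpp
    by_cases h0' : p' = 0
    · subst h0'
      rw [add_zero] at hpp ⊢
      exact hp hpp
    obtain ⟨a, b, d, hd, hq⟩ := hp h0
    obtain ⟨-, -, d', hd', hq'⟩ := hp' h0'
    have : d = d' := by omega
    subst this
    exact ⟨a, b, d, hd.add hd', hq⟩
  refine key _ _ h ?_ ?_
  · intro h1
    by_cases hk : k = l
    · subst hk
      rw [if_pos rfl] at h1 ⊢
      obtain ⟨a, b, d, hd, hq⟩ := hA i j h1
      exact ⟨by omega, by omega, d, hd, by omega⟩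
    · exact absurd (if_neg hk) h1
  · intro h1
    by_cases hi : i = j
    · subst hi
      rw [if_pos rfl] at h1 ⊢
      obtain ⟨a, b, d, hd, hq⟩ := hB k l (right_ne_zero_of_mul h1)
      exact ⟨by omega, by omega, d, hd.C_mul _, by omega⟩
    · exact absurd (if_neg hi) h1

/-- The tensor product over `R` of two complexes of complexes: rows and bidegrees add, and each of
the two differentials is `d ⊗ 1 + (-1) ^ deg ⊗ d`, with the sign given by the position in the
horizontal complex for the horizontal differential, and by the row for the vertical one. -/
def tensor (C D : FreeBicomplex n) : FreeBicomplex n where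
  ι := C.ι × D.ι
  row i := C.row i.1 + D.row i.2
  tdeg i := C.tdeg i.1 + D.tdeg i.2
  qdeg i := C.qdeg i.1 + D.qdeg i.2
  hor := C.hor ⊗ₖ (1 : Matrix D.ι D.ι (PolyRing n)) + sgn n C.tdeg ⊗ₖ D.hor
  vert := C.vert ⊗ₖ (1 : Matrix D.ι D.ι (PolyRing n)) + sgn n C.row ⊗ₖ D.vert
  hor_deg := tensor_hasDegree _ C.hor_deg D.hor_deg
  vert_deg := tensor_hasDegree _ C.vert_deg D.vert_deg
  hor_hor := tensor_sq _ _ _ (fun i j h => (C.hor_deg i j h).2.1) C.hor_hor D.hor_hor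
  vert_vert := tensor_sq _ _ _ (fun i j h => (C.vert_deg i j h).1) C.vert_vert D.vert_vert
  hor_vert := by
    simp only [add_mul, mul_add, ← Matrix.mul_kronecker_mul, mul_one, one_mul, C.hor_vert,
      D.hor_vert, sgn_comm C.tdeg C.row,
      mul_sgn_of_even _ _ fun i j h => (C.hor_deg i j h).1.trans (add_zero _),
      mul_sgn_of_even _ _ fun i j h => (C.vert_deg i j h).2.1.trans (add_zero _)]
    abel

/-- The unit of the tensor product: `R` in row `0` and bidegree `(0, 0)`. -/
def unit (n : ℕ) : FreeBicomplex n where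
  ι := Unit
  row _ := 0
  tdeg _ := 0
  qdeg _ := 0
  hor := 0
  vert := 0
  hor_deg _ _ h := absurd rfl h
  vert_deg _ _ h := absurd rfl h
  hor_hor := mul_zero _
  vert_vert := mul_zero _
  hor_vert := rfl

/-- The tensor product of a list of complexes of complexes. -/
def tensorList (l : List (FreeBicomplex n)) : FreeBicomplex n := l.foldr tensor (unit n)

/-! ### The factors attached to the edges and to the vertices -/

/-- The complex of complexes `D_e` of an edge `e` with ends `i` and `j`:
row `-1` is `0 → R{-1,2} → R{0,1} → 0` with differential `x_i - x_j`,
row `0` is `0 → R{-1,1} → R → 0` with differential `0`,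
and the vertical map is `x_i - x_j` on the left and `0` on the right.
In a basis element `(c, l)`, `c` says whether it lies in row `-1` (the edge is contracted), and
`l` whether it is the left term of its row; `R{a,b}` is the free module generated in
bidegree `(a, b)`. -/
def edgeFactor (i j : Fin n) : FreeBicomplex n where
  ι := Bool × Bool
  row p := if p.1 then -1 else 0
  tdeg p := if p.2 then -1 else 0
  qdeg p := (if p.1 then 1 else 0) + (if p.2 then 1 else 0)
  hor := Matrix.single (true, false) (true, true) (MvPolynomial.X i - MvPolynomial.X j)
  vert := Matrix.single (false, true) (true, true) (MvPolynomial.X i - MvPolynomial.X j)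
  hor_deg p p' h := by
    rw [Matrix.single_apply] at h ⊢
    obtain ⟨⟨rfl, rfl⟩, -⟩ := ite_ne_right_iff.1 h
    exact ⟨by simp, by simp, 1, by
      simpa using (MvPolynomial.isHomogeneous_X ℚ i).sub (MvPolynomial.isHomogeneous_X ℚ j),
      by simp⟩
  vert_deg p p' h := by
    rw [Matrix.single_apply] at h ⊢
    obtain ⟨⟨rfl, rfl⟩, -⟩ := ite_ne_right_iff.1 h
    exact ⟨by simp, by simp, 1, by
      simpa using (MvPolynomial.isHomogeneous_X ℚ i).sub (MvPolynomial.isHomogeneous_X ℚ j),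
      by simp⟩
  hor_hor := Matrix.single_mul_single_of_ne _ _ _ _ (by decide) _
  vert_vert := Matrix.single_mul_single_of_ne _ _ _ _ (by decide) _
  hor_vert := by
    rw [Matrix.single_mul_single_of_ne _ _ _ _ (by decide),
      Matrix.single_mul_single_of_ne _ _ _ _ (by decide)]

/-- The complex `0 → R{-1,1} → R → 0` with differential `0` attached to every vertex, as a complex
of complexes with the single row `0`; the basis element `true` is the left term. -/
def vertexFactor (n : ℕ) : FreeBicomplex n where
  ι := Bool
  row _ := 0
  tdeg p := if p then -1 else 0
  qdeg p := if p then 1 else 0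
  hor := 0
  vert := 0
  hor_deg _ _ h := absurd rfl h
  vert_deg _ _ h := absurd rfl h
  hor_hor := mul_zero _
  vert_vert := mul_zero _
  hor_vert := rfl

/-! ### Rows, their cohomology and its bigrading -/

variable (C : FreeBicomplex n)

/-- The term of row `j` (the sum of all terms of the horizontal complex number `j`):
vectors supported on the basis elements of that row. -/
def rowModule (j : ℤ) : Submodule (PolyRing n) (C.ι → PolyRing n) where
  carrier := {f | ∀ i, C.row i ≠ j → f i = 0}
  add_mem' hf hg i hi := by simp [hf i hi, hg i hi]
  zero_mem' _ _ := rfl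
  smul_mem' c f hf i hi := by simp [hf i hi]

theorem mulVec_mem_rowModule {A : Matrix C.ι C.ι (PolyRing n)} {r t : ℤ}
    (hA : HasDegree C.row C.tdeg C.qdeg r t A) {j : ℤ} {f : C.ι → PolyRing n}
    (hf : f ∈ C.rowModule j) : A.mulVec f ∈ C.rowModule (j + r) := by
  intro i hi
  rw [Matrix.mulVec, dotProduct]
  refine Finset.sum_eq_zero fun k _ => ?_
  by_cases h : A i k = 0
  · rw [h, zero_mul]
  · rw [hf k fun hk => hi (by rw [(hA i k h).1, hk]), mul_zero]

/-- The cocycles of the horizontal complex in row `j`. -/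
def cocycles (j : ℤ) : Submodule (PolyRing n) (C.ι → PolyRing n) :=
  C.rowModule j ⊓ LinearMap.ker C.hor.mulVecLin

/-- The coboundaries of the horizontal complex in row `j`. -/
def coboundaries (j : ℤ) : Submodule (PolyRing n) (C.ι → PolyRing n) :=
  (C.rowModule j).map C.hor.mulVecLin

theorem coboundaries_le_cocycles (j : ℤ) : C.coboundaries j ≤ C.cocycles j := by
  rintro _ ⟨f, hf, rfl⟩
  refine ⟨by simpa using C.mulVec_mem_rowModule C.hor_deg hf, ?_⟩
  change C.hor.mulVec (C.hor.mulVec f) = 0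
  rw [Matrix.mulVec_mulVec, C.hor_hor, Matrix.zero_mulVec]

/-- The cohomology `H^j` of the horizontal complex in row `j`
(the direct sum of all its cohomology groups). -/
abbrev Cohomology (j : ℤ) : Type := C.cocycles j ⧸ (C.coboundaries j).submoduleOf (C.cocycles j)

theorem vert_mem_cocycles {j : ℤ} {f : C.ι → PolyRing n} (hf : f ∈ C.cocycles j) :
    C.vert.mulVecLin f ∈ C.cocycles (j + 1) := by
  have h0 : C.hor.mulVec f = 0 := hf.2
  refine ⟨C.mulVec_mem_rowModule C.vert_deg hf.1, ?_⟩
  change C.hor.mulVec (C.vert.mulVec f) = 0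
  rw [Matrix.mulVec_mulVec, C.hor_vert, ← Matrix.mulVec_mulVec, h0, Matrix.mulVec_zero]

/-- The vertical differential, as a map from the cocycles of row `j` to those of row `j + 1`. -/
def cocycleMap (j : ℤ) : C.cocycles j →ₗ[PolyRing n] C.cocycles (j + 1) :=
  C.vert.mulVecLin.restrict fun _ hf => C.vert_mem_cocycles hf

/-- The map induced by the vertical differential on the cohomology of the rows. -/
def cohomologyMap (j : ℤ) : C.Cohomology j →ₗ[PolyRing n] C.Cohomology (j + 1) :=
  Submodule.mapQ _ _ (C.cocycleMap j) <| by
    rintro ⟨_, h⟩ ⟨g, hg, rfl⟩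
    refine ⟨C.vert.mulVec g, C.mulVec_mem_rowModule C.vert_deg hg, ?_⟩
    change C.hor.mulVec (C.vert.mulVec g) = C.vert.mulVec (C.hor.mulVec g)
    rw [Matrix.mulVec_mulVec, Matrix.mulVec_mulVec, C.hor_vert]

theorem cohomologyMap_cohomologyMap (j : ℤ) (x : C.Cohomology j) :
    C.cohomologyMap (j + 1) (C.cohomologyMap j x) = 0 := by
  obtain ⟨⟨f, hf⟩, rfl⟩ := Submodule.mkQ_surjective _ x
  have : C.cocycleMap (j + 1) (C.cocycleMap j ⟨f, hf⟩) = 0 := by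
    ext1
    change C.vert.mulVec (C.vert.mulVec f) = 0
    rw [Matrix.mulVec_mulVec, C.vert_vert, Matrix.zero_mulVec]
  change Submodule.Quotient.mk (C.cocycleMap (j + 1) (C.cocycleMap j ⟨f, hf⟩)) = 0
  rw [this]
  rfl

/-- The vectors of bidegree `p = (a, b)`: every nonzero entry sits at a basis element `i` of
`t`-degree `a`, and is a homogeneous polynomial of degree `b - qdeg i`. -/
def homog (p : ℤ × ℤ) : Submodule ℚ (C.ι → PolyRing n) where
  carrier := {f | ∀ i, f i ≠ 0 → C.tdeg i = p.1 ∧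
    ∃ d : ℕ, (f i).IsHomogeneous d ∧ p.2 = C.qdeg i + d}
  zero_mem' _ h := absurd rfl h
  add_mem' {f g} hf hg i h := by
    by_cases h1 : f i = 0
    · simp only [Pi.add_apply, h1, zero_add] at h ⊢
      exact hg i h
    by_cases h2 : g i = 0
    · simp only [Pi.add_apply, h2, add_zero] at h ⊢
      exact hf i h
    obtain ⟨a, d, hd, hq⟩ := hf i h1
    obtain ⟨-, d', hd', hq'⟩ := hg i h2
    have : d = d' := by omega
    subst this
    exact ⟨a, d, hd.add hd', hq⟩
  smul_mem' c f hf i h := by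
    have h1 : f i ≠ 0 := fun h0 => h (by simp [h0])
    obtain ⟨a, d, hd, hq⟩ := hf i h1
    refine ⟨a, d, ?_, hq⟩
    rw [Pi.smul_apply, MvPolynomial.smul_eq_C_mul]
    exact hd.C_mul c

/-- The part of bidegree `p` of `H^j`: the classes of the cocycles of bidegree `p`. -/
def cohomologyPiece (j : ℤ) (p : ℤ × ℤ) : Submodule ℚ (C.Cohomology j) where
  carrier := {x | ∃ f : C.cocycles j, (f : C.ι → PolyRing n) ∈ C.homog p ∧
    Submodule.Quotient.mk f = x}
  zero_mem' := ⟨0, (C.homog p).zero_mem, rfl⟩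
  add_mem' := by
    rintro _ _ ⟨f, hf, rfl⟩ ⟨g, hg, rfl⟩
    exact ⟨f + g, (C.homog p).add_mem hf hg, rfl⟩
  smul_mem' := by
    rintro c _ ⟨f, hf, rfl⟩
    exact ⟨c • f, (C.homog p).smul_mem c hf, rfl⟩

/-- The projection of a vector to its part of bidegree `p`. -/
def proj (p : ℤ × ℤ) (f : C.ι → PolyRing n) (i : C.ι) : PolyRing n :=
  if C.tdeg i = p.1 ∧ C.qdeg i ≤ p.2 then
    MvPolynomial.homogeneousComponent (p.2 - C.qdeg i).toNat (f i) else 0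

theorem proj_mem_homog (p : ℤ × ℤ) (f : C.ι → PolyRing n) : C.proj p f ∈ C.homog p := by
  intro i h
  unfold proj at h ⊢
  split_ifs at h ⊢ with h1
  · exact ⟨h1.1, _, MvPolynomial.homogeneousComponent_isHomogeneous _ _, by omega⟩
  · exact absurd rfl h

theorem proj_add (p : ℤ × ℤ) (f g : C.ι → PolyRing n) :
    C.proj p (f + g) = C.proj p f + C.proj p g := by
  ext1 i
  simp only [proj, Pi.add_apply, map_add]
  split_ifs <;> simp

theorem proj_sum {κ : Type} (s : Finset κ) (p : ℤ × ℤ) (f : κ → C.ι → PolyRing n) :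
    C.proj p (∑ k ∈ s, f k) = ∑ k ∈ s, C.proj p (f k) :=
  map_sum (AddMonoidHom.mk' (C.proj p) (C.proj_add p)) f s

theorem proj_of_mem {p : ℤ × ℤ} {f : C.ι → PolyRing n} (hf : f ∈ C.homog p) :
    C.proj p f = f := by
  ext1 i
  by_cases h : f i = 0
  · simp [proj, h]
  · obtain ⟨a, d, hd, hq⟩ := hf i h
    rw [proj, if_pos ⟨a, by omega⟩, show (p.2 - C.qdeg i).toNat = d by omega,
      MvPolynomial.homogeneousComponent_of_mem hd, if_pos rfl]

theorem proj_of_mem_ne {p p' : ℤ × ℤ} (hp : p' ≠ p) {f : C.ι → PolyRing n}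
    (hf : f ∈ C.homog p') : C.proj p f = 0 := by
  ext1 i
  by_cases h : f i = 0
  · simp [proj, h]
  · obtain ⟨a, d, hd, hq⟩ := hf i h
    rw [proj, Pi.zero_apply]
    split_ifs with h1
    · rw [MvPolynomial.homogeneousComponent_of_mem hd, if_neg]
      intro h2
      exact hp (Prod.ext (by omega) (by omega))
    · rfl

theorem proj_mem_rowModule (p : ℤ × ℤ) {j : ℤ} {f : C.ι → PolyRing n}
    (hf : f ∈ C.rowModule j) : C.proj p f ∈ C.rowModule j := by
  intro i hi
  simp [proj, hf i hi]

theorem homogeneousComponent_mul {a b : PolyRing n} {d : ℕ} (ha : a.IsHomogeneous d) (k : ℕ) :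
    MvPolynomial.homogeneousComponent k (a * b) =
      if d ≤ k then a * MvPolynomial.homogeneousComponent (k - d) b else 0 := by
  let _ := MvPolynomial.gradedAlgebra (σ := Fin n) (R := ℚ)
  have e : ∀ (x : PolyRing n) (l : ℕ), (DirectSum.decompose
      (MvPolynomial.homogeneousSubmodule (Fin n) ℚ) x l : PolyRing n) =
        MvPolynomial.homogeneousComponent l x :=
    fun x l => MvPolynomial.decomposition.decompose'_apply x l
  have ha' := (MvPolynomial.mem_homogeneousSubmodule d a).2 ha
  split_ifs with h
  · have := DirectSum.coe_decompose_mul_add_of_left_mem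
      (MvPolynomial.homogeneousSubmodule (Fin n) ℚ) (j := k - d) (b := b) ha'
    rwa [e, e, Nat.add_sub_cancel' h] at this
  · have := DirectSum.coe_decompose_mul_of_left_mem_of_not_le
      (MvPolynomial.homogeneousSubmodule (Fin n) ℚ) (b := b) ha' h
    rwa [e] at this

theorem mulVec_proj {A : Matrix C.ι C.ι (PolyRing n)} {r t : ℤ}
    (hA : HasDegree C.row C.tdeg C.qdeg r t A) (p : ℤ × ℤ) (f : C.ι → PolyRing n) :
    A.mulVec (C.proj p f) = C.proj (p.1 + t, p.2) (A.mulVec f) := by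
  ext1 i
  simp only [Matrix.mulVec, dotProduct, proj]
  have h0 : ∀ k, A i k * (if C.tdeg k = p.1 ∧ C.qdeg k ≤ p.2 then
        MvPolynomial.homogeneousComponent (p.2 - C.qdeg k).toNat (f k) else 0) =
      if C.tdeg i = p.1 + t ∧ C.qdeg i ≤ p.2 then
        MvPolynomial.homogeneousComponent (p.2 - C.qdeg i).toNat (A i k * f k) else 0 := by
    intro k
    by_cases h : A i k = 0
    · simp [h]
    obtain ⟨-, ht, d, hd, hq⟩ := hA i k h
    by_cases h1 : C.tdeg k = p.1 ∧ C.qdeg k ≤ p.2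
    · rw [if_pos h1, if_pos ⟨by omega, by omega⟩, homogeneousComponent_mul hd, if_pos (by omega),
        show (p.2 - C.qdeg i).toNat - d = (p.2 - C.qdeg k).toNat by omega]
    · rw [if_neg h1, mul_zero]
      split_ifs with h2
      · rw [homogeneousComponent_mul hd, if_neg (by omega)]
      · rfl
  rw [Finset.sum_congr rfl fun k _ => h0 k]
  split_ifs
  · rw [map_sum]
  · simp

theorem proj_mem_cocycles (p : ℤ × ℤ) {j : ℤ} {f : C.ι → PolyRing n} (hf : f ∈ C.cocycles j) :
    C.proj p f ∈ C.cocycles j := by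
  have h0 : C.hor.mulVec f = 0 := hf.2
  refine ⟨C.proj_mem_rowModule p hf.1, ?_⟩
  change C.hor.mulVec (C.proj p f) = 0
  rw [C.mulVec_proj C.hor_deg, h0]
  ext1 i
  simp [proj]

theorem eq_sum_proj (f : C.ι → PolyRing n) :
    ∃ s : Finset (ℤ × ℤ), f = ∑ p ∈ s, C.proj p f := by
  classical
  refine ⟨Finset.univ.biUnion fun i => (Finset.range ((f i).totalDegree + 1)).image
    fun d : ℕ => (C.tdeg i, C.qdeg i + d), ?_⟩
  ext1 i
  rw [Finset.sum_apply]
  have hinj : Function.Injective fun d : ℕ => (C.tdeg i, C.qdeg i + (d : ℤ)) := by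
    intro a b h
    simpa using h
  rw [← Finset.sum_subset (s₁ := (Finset.range ((f i).totalDegree + 1)).image
    fun d : ℕ => (C.tdeg i, C.qdeg i + (d : ℤ)))]
  · rw [Finset.sum_image (fun a _ b _ h => hinj h)]
    conv_lhs => rw [← MvPolynomial.sum_homogeneousComponent (f i)]
    refine Finset.sum_congr rfl fun d _ => ?_
    rw [proj, if_pos ⟨rfl, by dsimp only; omega⟩]
    congr 2
    dsimp only
    omega
  · intro p hp
    exact Finset.mem_biUnion.2 ⟨i, Finset.mem_univ _, hp⟩
  · intro p _ hp
    rw [proj]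
    split_ifs with h
    · refine MvPolynomial.homogeneousComponent_eq_zero _ _ ?_
      by_contra hlt
      refine hp (Finset.mem_image.2 ⟨(p.2 - C.qdeg i).toNat, Finset.mem_range.2 (by omega), ?_⟩)
      exact Prod.ext h.1 (by dsimp only; omega)
    · rfl

/-- The pieces of the various bidegrees make `H^j` a bigraded vector space. -/
theorem isInternal_cohomologyPiece (j : ℤ) : DirectSum.IsInternal (C.cohomologyPiece j) := by
  classical
  constructor
  · rw [injective_iff_map_eq_zero]
    intro v hv
    rw [DirectSum.coeAddMonoidHom_eq_dfinsuppSum, DFinsupp.sum] at hv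
    choose g hg hgv using fun p => (v p).2
    have hsum : (∑ p ∈ DFinsupp.support v, (g p : C.ι → PolyRing n)) ∈ C.coboundaries j := by
      have h1 : Submodule.Quotient.mk (p := (C.coboundaries j).submoduleOf (C.cocycles j))
          (∑ p ∈ DFinsupp.support v, g p) = 0 := by
        rw [← Submodule.mkQ_apply, map_sum, ← hv]
        exact Finset.sum_congr rfl fun p _ => hgv p
      have h2 := (Submodule.Quotient.mk_eq_zero _).1 h1
      simpa [Submodule.submoduleOf] using h2
    obtain ⟨w, hw, hw'⟩ := hsum
    ext p
    by_cases hp : p ∈ DFinsupp.support v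
    · have h3 : (g p : C.ι → PolyRing n) = C.hor.mulVec (C.proj (p.1 - 1, p.2) w) := by
        rw [C.mulVec_proj C.hor_deg]
        change C.hor.mulVec w = _ at hw'
        rw [hw', C.proj_sum, Finset.sum_eq_single_of_mem p hp fun p' _ hne =>
          C.proj_of_mem_ne (by simpa using hne) (hg p')]
        simp only [sub_add_cancel]
        exact (C.proj_of_mem (hg p)).symm
      rw [← hgv p]
      exact (Submodule.Quotient.mk_eq_zero _).2
        ⟨C.proj (p.1 - 1, p.2) w, C.proj_mem_rowModule _ hw, h3.symm⟩
    · rw [DFinsupp.notMem_support_iff.1 hp]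
      rfl
  · intro x
    obtain ⟨⟨f, hf⟩, rfl⟩ := Submodule.mkQ_surjective _ x
    obtain ⟨s, hs⟩ := C.eq_sum_proj f
    refine ⟨∑ p ∈ s, DirectSum.of (fun p => C.cohomologyPiece j p) p
      ⟨Submodule.Quotient.mk ⟨C.proj p f, C.proj_mem_cocycles p hf⟩,
        _, C.proj_mem_homog p f, rfl⟩, ?_⟩
    rw [map_sum]
    simp only [DirectSum.coeAddMonoidHom_of]
    have : (⟨f, hf⟩ : C.cocycles j) = ∑ p ∈ s, ⟨C.proj p f, C.proj_mem_cocycles p hf⟩ := by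
      ext1
      simpa using hs
    rw [this, map_sum]
    rfl

theorem smul_mem_cohomologyPiece (j : ℤ) {d : ℕ} {c : PolyRing n} (hc : c.IsHomogeneous d)
    {p : ℤ × ℤ} {x : C.Cohomology j} (hx : x ∈ C.cohomologyPiece j p) :
    c • x ∈ C.cohomologyPiece j (p.1, p.2 + d) := by
  obtain ⟨f, hf, rfl⟩ := hx
  refine ⟨c • f, ?_, rfl⟩
  intro i hi
  obtain ⟨a, e, he, hq⟩ := hf i (right_ne_zero_of_mul hi)
  exact ⟨a, d + e, hc.mul he, by push_cast; omega⟩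

theorem cohomologyMap_mem (j : ℤ) {p : ℤ × ℤ} {x : C.Cohomology j}
    (hx : x ∈ C.cohomologyPiece j p) : C.cohomologyMap j x ∈ C.cohomologyPiece (j + 1) p := by
  obtain ⟨f, hf, rfl⟩ := hx
  refine ⟨C.cocycleMap j f, ?_, rfl⟩
  change C.vert.mulVec f ∈ C.homog p
  have := C.mulVec_proj C.vert_deg p f
  rw [C.proj_of_mem hf, add_zero] at this
  rw [this]
  exact C.proj_mem_homog _ _

end FreeBicomplex

/-! ### Bigraded modules -/

/-- A bigraded module over the bigraded ring `R = ℚ[x₁, …, xₙ]`. -/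
structure BigradedModule (n : ℕ) where
  carrier : Type
  [addCommGroup : AddCommGroup carrier]
  [moduleRat : Module ℚ carrier]
  [module : Module (PolyRing n) carrier]
  [isScalarTower : IsScalarTower ℚ (PolyRing n) carrier]
  /-- the homogeneous part of each bidegree -/
  piece : ℤ × ℤ → Submodule ℚ carrier
  isInternal : DirectSum.IsInternal piece
  smul_mem : ∀ (d : ℕ) (c : PolyRing n), c.IsHomogeneous d → ∀ (p : ℤ × ℤ) (x : carrier),
    x ∈ piece p → c • x ∈ piece (p.1, p.2 + d)

namespace BigradedModule

variable {n : ℕ}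

attribute [instance] addCommGroup moduleRat module isScalarTower

/-- A morphism of bigraded modules: an `R`-linear map preserving the bidegree. -/
@[ext]
structure Hom (M N : BigradedModule n) where
  toLin : M.carrier →ₗ[PolyRing n] N.carrier
  map_mem : ∀ (p : ℤ × ℤ) (x : M.carrier), x ∈ M.piece p → toLin x ∈ N.piece p

instance : Category (BigradedModule n) where
  Hom M N := Hom M N
  id M := ⟨LinearMap.id, fun _ _ h => h⟩
  comp f g := ⟨g.toLin ∘ₗ f.toLin, fun p x h => g.map_mem p _ (f.map_mem p x h)⟩

@[ext]
theorem hom_ext {M N : BigradedModule n} {f g : M ⟶ N} (h : Hom.toLin f = Hom.toLin g) : f = g :=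
  Hom.ext h

variable {M N : BigradedModule n}

instance : Zero (M ⟶ N) := ⟨⟨0, fun p _ _ => (N.piece p).zero_mem⟩⟩
instance : Add (M ⟶ N) := ⟨fun f g => ⟨f.toLin + g.toLin, fun p x h =>
  (N.piece p).add_mem (f.map_mem p x h) (g.map_mem p x h)⟩⟩
instance : Neg (M ⟶ N) := ⟨fun f => ⟨-f.toLin, fun p x h =>
  (N.piece p).neg_mem (f.map_mem p x h)⟩⟩
instance : Sub (M ⟶ N) := ⟨fun f g => ⟨f.toLin - g.toLin, fun p x h =>
  (N.piece p).sub_mem (f.map_mem p x h) (g.map_mem p x h)⟩⟩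
instance : SMul ℕ (M ⟶ N) := ⟨fun k f => ⟨k • f.toLin, fun p x h =>
  (N.piece p).nsmul_mem (f.map_mem p x h) k⟩⟩
instance : SMul ℤ (M ⟶ N) := ⟨fun k f => ⟨k • f.toLin, fun p x h =>
  zsmul_mem (f.map_mem p x h) k⟩⟩

instance : AddCommGroup (M ⟶ N) :=
  Function.Injective.addCommGroup (Hom.toLin : (M ⟶ N) → _) (fun _ _ => hom_ext) rfl
    (fun _ _ => rfl) (fun _ => rfl) (fun _ _ => rfl) (fun _ _ => rfl) (fun _ _ => rfl)

instance : Preadditive (BigradedModule n) where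
  add_comp _ _ _ f f' g := hom_ext (LinearMap.comp_add (Hom.toLin f) (Hom.toLin f') (Hom.toLin g))
  comp_add _ _ _ f g g' := hom_ext (LinearMap.add_comp (Hom.toLin f) (Hom.toLin g') (Hom.toLin g))

/-- The ring automorphism of `R` with `xᵢ ↦ x_{σ i}`. -/
def permuteVars (σ : Equiv.Perm (Fin n)) : PolyRing n →+* PolyRing n :=
  (MvPolynomial.rename σ : PolyRing n →ₐ[ℚ] PolyRing n).toRingHom

/-- Restriction of scalars along the automorphism of `R` that permutes the variables by `σ`:
`xᵢ` acts on the new module as `x_{σ i}` acts on the old one. -/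
def permuteObj (σ : Equiv.Perm (Fin n)) (M : BigradedModule n) : BigradedModule n where
  carrier := M.carrier
  module := Module.compHom M.carrier (permuteVars σ)
  isScalarTower := by
    refine @IsScalarTower.mk _ _ _ _ (_) _ fun a c x => ?_
    change (MvPolynomial.rename σ (a • c) : PolyRing n) • x =
      a • ((MvPolynomial.rename σ c : PolyRing n) • x)
    rw [map_smul, smul_assoc]
  piece := M.piece
  isInternal := M.isInternal
  smul_mem := fun d c hc p x hx =>
    M.smul_mem d (MvPolynomial.rename σ c) hc.rename_isHomogeneous p x hx

/-- The functor `permuteObj σ`; it does not change the underlying maps. -/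
def permute (σ : Equiv.Perm (Fin n)) : BigradedModule n ⥤ BigradedModule n where
  obj M := permuteObj σ M
  map {M N} f :=
    { toLin :=
        { toFun := fun x : M.carrier => (Hom.toLin f x : N.carrier)
          map_add' := fun x y => LinearMap.map_add (Hom.toLin f) x y
          map_smul' := fun c x => LinearMap.map_smul (Hom.toLin f) (permuteVars σ c) x }
      map_mem := fun p x h => Hom.map_mem f p x h }
  map_id _ := rfl
  map_comp _ _ := rfl

instance (σ : Equiv.Perm (Fin n)) : (permute σ).Additive where
  map_add {_ _ _ _} := rfl

end BigradedModule

namespace FreeBicomplex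

variable {n : ℕ} (C : FreeBicomplex n)

/-- The cohomology `H^j` of the horizontal complex in row `j` as a bigraded module. -/
def cohomologyModule (j : ℤ) : BigradedModule n where
  carrier := C.Cohomology j
  piece := C.cohomologyPiece j
  isInternal := C.isInternal_cohomologyPiece j
  smul_mem _ _ hc _ _ hx := C.smul_mem_cohomologyPiece j hc hx

/-- The complex of bigraded modules formed by the cohomologies of the horizontal complexes, with
the maps induced by the vertical differential. -/
def cohomologyComplex : CochainComplex (BigradedModule n) ℤ :=
  CochainComplex.of C.cohomologyModule
    (fun j => ⟨C.cohomologyMap j, fun _ _ hx => C.cohomologyMap_mem j hx⟩)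
    (fun j => BigradedModule.hom_ext (LinearMap.ext fun x => C.cohomologyMap_cohomologyMap j x))

end FreeBicomplex

/-- The coefficient of `t ^ a * q ^ b` in the bigraded Euler characteristic
`∑ⱼ (-1) ^ j qdim (K ^ j)` of a complex of bigraded modules. -/
def eulerChar {n : ℕ} (K : CochainComplex (BigradedModule n) ℤ) (a b : ℤ) : ℤ :=
  ∑ᶠ j : ℤ, (Int.negOnePow j : ℤ) * (Module.finrank ℚ ((K.X j).piece (a, b)) : ℤ)

/-! ### Graphs and the complex of a graph -/

variable {α β α' β' : Type*}

/-- An isomorphism of multigraphs. -/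
structure GraphIso (G : Graph α β) (G' : Graph α' β') where
  vertexEquiv : V(G) ≃ V(G')
  edgeEquiv : E(G) ≃ E(G')
  isLink_iff : ∀ (e : E(G)) (x y : V(G)),
    G'.IsLink (edgeEquiv e) (vertexEquiv x) (vertexEquiv y) ↔ G.IsLink e x y

/-- The choices made in the construction of the complex of a finite multigraph with `n` vertices
and `m` edges: an ordering of the vertices, an ordering of the edges, and an order of the two ends
of each edge (loops have equal ends). -/
structure Labelling (G : Graph α β) (n m : ℕ) where
  vertex : V(G) ≃ Fin n
  edge : E(G) ≃ Fin m
  fst : Fin m → Fin n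
  snd : Fin m → Fin n
  isLink : ∀ k, G.IsLink (edge.symm k) (vertex.symm (fst k)) (vertex.symm (snd k))

/-- The tensor product of the complexes of complexes `D_e` over all edges `e` and of the complexes
attached to the vertices. -/
def Labelling.bicomplex {G : Graph α β} {n m : ℕ} (L : Labelling G n m) : FreeBicomplex n :=
  FreeBicomplex.tensorList
    (List.ofFn (fun k : Fin m => FreeBicomplex.edgeFactor (L.fst k) (L.snd k)) ++
      List.ofFn (fun _ : Fin n => FreeBicomplex.vertexFactor n))

/-- The triply graded complex `D(G)`. -/
def Labelling.complex {G : Graph α β} {n m : ℕ} (L : Labelling G n m) :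
    CochainComplex (BigradedModule n) ℤ :=
  L.bicomplex.cohomologyComplex

/-! ### The dichromatic polynomial -/

/-- The number of connected components of a graph. -/
def numComponents (G : Graph α β) : ℕ := Nat.card (Quot fun x y : V(G) => G.Adj x y)

/-- The graph `G/e` for an edge `e` with ends `x` and `y`: delete `e` and identify `y` with `x`. -/
def contract (G : Graph α β) (e : β) (x y : α) : Graph α β :=
  open Classical in (G.deleteEdges {e}).map (Function.update id y x)

/-- The axioms of the dichromatic polynomial `P_G(q, v)` (the variables `0` and `1` are `q` and
`v`) for finite multigraphs:
`P_G = P_{G-e} - q P_{G/e}` for every edge `e`, and `P_N = v ^ k` if `N` has `k` vertices and no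
edges. -/
structure IsDichromatic (P : Graph α β → MvPolynomial (Fin 2) ℤ) : Prop where
  deletion_contraction : ∀ (G : Graph α β) (e : β) (x y : α), V(G).Finite → E(G).Finite →
    G.IsLink e x y → P G = P (G.deleteEdges {e}) - MvPolynomial.X 0 * P (contract G e x y)
  noEdge : ∀ s : Set α, s.Finite → P (Graph.noEdge s β) = MvPolynomial.X 1 ^ s.ncard

/-- The dichromatic polynomial `P_G(q, v) = ∑_{s ⊆ E(G)} (-1) ^ |s| q ^ |s| v ^ k(s)`, where `k(s)`
is the number of connected components of the spanning subgraph with edge set `s`. By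
`isDichromatic_dichromatic` and `IsDichromatic.eq_dichromatic`, it is the one and only solution of
the axioms. -/
def dichromatic (G : Graph α β) : MvPolynomial (Fin 2) ℤ :=
  ∑ᶠ s ∈ E(G).powerset,
    (-1) ^ s.ncard * MvPolynomial.X 0 ^ s.ncard * MvPolynomial.X 1 ^ numComponents (G.restrict s)

theorem numComponents_noEdge (s : Set α) (t : Set β) :
    numComponents ((Graph.noEdge s β).restrict t) = s.ncard := by
  rw [numComponents, ← Nat.card_coe_set_eq]
  refine Nat.card_congr (Equiv.ofBijective (Quot.mk _) ⟨fun x y h => ?_, Quot.mk_surjective⟩).symm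
  have h' := Quot.eqvGen_exact h
  have : ∀ x y, Relation.EqvGen (fun x y : V((Graph.noEdge s β).restrict t) =>
      ((Graph.noEdge s β).restrict t).Adj x y) x y → x = y := by
    intro x y h
    induction h with
    | rel x y h =>
      obtain ⟨e, -, he⟩ := h
      exact he.elim
    | refl x => rfl
    | symm x y _ ih => exact ih.symm
    | trans x y z _ _ ih1 ih2 => exact ih1.trans ih2
  exact this x y h'

theorem numComponents_contract (G : Graph α β) {e : β} {x y : α} (h : G.IsLink e x y)
    {s : Set β} (hs : e ∉ s) :
    numComponents ((contract G e x y).restrict s) = numComponents (G.restrict (insert e s)) := by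
  classical
  set φ : α → α := Function.update id y x with hφ
  have hφy : φ y = x := by simp [hφ]
  have hφn : ∀ u, u ≠ y → φ u = u := fun u hu => by simp [hφ, hu]
  have hφx : φ x = x := by
    by_cases hxy : x = y
    · rw [hxy] at hφy ⊢
      exact hφy
    · exact hφn x hxy
  have hφφ : ∀ u, φ (φ u) = φ u := fun u => by
    by_cases hu : u = y
    · rw [hu, hφy, hφx]
    · rw [hφn u hu, hφn u hu]
  have hV : V((contract G e x y).restrict s) = φ '' V(G) := by
    simp [contract, hφ]
  have hsub : ∀ v ∈ V((contract G e x y).restrict s), v ∈ V(G) := by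
    rw [hV]
    rintro _ ⟨u, hu, rfl⟩
    by_cases huy : u = y
    · rw [huy, hφy]
      exact h.left_mem
    · rwa [hφn u huy]
  have hlink : ∀ f a b, ((contract G e x y).restrict s).IsLink f a b ↔
      f ∈ s ∧ ∃ u w, G.IsLink f u w ∧ φ u = a ∧ φ w = b := by
    intro f a b
    simp only [contract, Graph.restrict_isLink, Graph.map_isLink, Relation.map_apply,
      Graph.deleteEdges_isLink, Set.mem_singleton_iff]
    constructor
    · rintro ⟨hf, u, w, ⟨h1, -⟩, h2, h3⟩
      exact ⟨hf, u, w, h1, by rw [← h2, hφ], by rw [← h3, hφ]⟩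
    · rintro ⟨hf, u, w, h1, h2, h3⟩
      exact ⟨hf, u, w, ⟨h1, fun he => hs (he ▸ hf)⟩, by rw [← h2, hφ], by rw [← h3, hφ]⟩
  have hmk : ∀ (u : α) (hu : u ∈ V(G)) (hu' : φ u ∈ V(G)),
      (Quot.mk (fun a b : V(G.restrict (insert e s)) => (G.restrict (insert e s)).Adj a b)
        ⟨φ u, hu'⟩) = Quot.mk _ ⟨u, hu⟩ := by
    intro u hu hu'
    by_cases huy : u = y
    · subst huy
      refine Quot.sound ⟨e, Set.mem_insert e s, ?_⟩
      change G.IsLink e (φ u) u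
      rwa [hφy]
    · congr 2
      exact hφn u huy
  refine Nat.card_congr
    { toFun := Quot.lift (fun v => Quot.mk _ ⟨v.1, hsub v.1 v.2⟩) ?_
      invFun := Quot.lift (fun v => Quot.mk _ ⟨φ v.1, hV ▸ Set.mem_image_of_mem φ v.2⟩) ?_
      left_inv := ?_
      right_inv := ?_ }
  · rintro ⟨a, ha⟩ ⟨b, hb⟩ ⟨f, hf⟩
    obtain ⟨hfs, u, w, huw, rfl, rfl⟩ := (hlink f a b).1 hf
    have h1 := hmk u huw.left_mem (hsub _ ha)
    have h2 := hmk w huw.right_mem (hsub _ hb)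
    refine h1.trans (Eq.trans (Quot.sound ?_) h2.symm)
    exact ⟨f, Set.mem_insert_of_mem e hfs, huw⟩
  · rintro ⟨a, ha⟩ ⟨b, hb⟩ ⟨f, hf, hab⟩
    rcases hf with rfl | hf
    · congr 2
      change φ a = φ b
      rcases hab.eq_and_eq_or_eq_and_eq h with ⟨h1, h2⟩ | ⟨h1, h2⟩
      · change a = x at h1
        change b = y at h2
        rw [h1, h2, hφx, hφy]
      · change a = y at h1
        change b = x at h2
        rw [h1, h2, hφx, hφy]
    · exact Quot.sound ⟨f, (hlink f _ _).2 ⟨hf, a, b, hab, rfl, rfl⟩⟩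
  · rintro ⟨⟨a, ha⟩⟩
    change Quot.mk _ _ = Quot.mk _ _
    congr 2
    obtain ⟨u, hu, rfl⟩ := hV ▸ ha
    exact hφφ u
  · rintro ⟨⟨a, ha⟩⟩
    exact hmk a ha _

theorem isDichromatic_dichromatic :
    IsDichromatic (dichromatic : Graph α β → MvPolynomial (Fin 2) ℤ) where
  deletion_contraction G e x y _ hE h := by
    classical
    have he : e ∈ E(G) := h.edge_mem
    have hfin : (E(G) \ {e}).powerset.Finite := (hE.subset Set.sdiff_subset).powerset
    have hsplit : E(G).powerset =
        (E(G) \ {e}).powerset ∪ (insert e) '' (E(G) \ {e}).powerset := by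
      conv_lhs => rw [← Set.insert_sdiff_self_of_mem he]
      rw [Set.powerset_insert]
    have hdisj : Disjoint (E(G) \ {e}).powerset ((insert e) '' (E(G) \ {e}).powerset) := by
      rw [Set.disjoint_left]
      rintro _ h1 ⟨t, -, rfl⟩
      exact (h1 (Set.mem_insert e t)).2 rfl
    have hinj : Set.InjOn (insert e) (E(G) \ {e}).powerset := by
      intro s hs t ht hst
      have hs' : e ∉ s := fun h' => (hs h').2 rfl
      have ht' : e ∉ t := fun h' => (ht h').2 rfl
      rw [← Set.insert_sdiff_self_of_notMem hs', ← Set.insert_sdiff_self_of_notMem ht', hst]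
    have hEc : E(contract G e x y) = E(G) \ {e} := by simp [contract]
    rw [dichromatic, dichromatic, dichromatic, hsplit, finsum_mem_union hdisj hfin (hfin.image _),
      finsum_mem_image hinj, sub_eq_add_neg, hEc, Graph.edgeSet_deleteEdges, ← neg_mul,
      mul_finsum_mem' _ _ hfin]
    congr 1
    · refine finsum_mem_congr rfl fun s hs => ?_
      congr 3
      refine Graph.ext rfl fun f a b => ?_
      simp only [Graph.restrict_isLink, Graph.deleteEdges_isLink, Set.mem_singleton_iff]
      exact ⟨fun h => ⟨h.1, h.2, (hs h.1).2⟩, fun h => ⟨h.1, h.2.1⟩⟩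
    · refine finsum_mem_congr rfl fun s hs => ?_
      have hs' : e ∉ s := fun h' => (hs h').2 rfl
      rw [numComponents_contract G h hs', Set.ncard_insert_of_notMem hs'
        ((hE.subset Set.sdiff_subset).subset hs)]
      ring
  noEdge s _ := by
    rw [dichromatic, Graph.edgeSet_noEdge, Set.powerset_empty, finsum_mem_singleton,
      numComponents_noEdge]
    simp

theorem IsDichromatic.eq_dichromatic {P : Graph α β → MvPolynomial (Fin 2) ℤ}
    (hP : IsDichromatic P) (G : Graph α β) (hV : V(G).Finite) (hE : E(G).Finite) :
    P G = dichromatic G := by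
  have hD := isDichromatic_dichromatic (α := α) (β := β)
  induction h : E(G).ncard generalizing G with
  | zero =>
    rw [Graph.edgeSet_eq_empty.1 ((Set.ncard_eq_zero hE).1 h), hP.noEdge _ hV, hD.noEdge _ hV]
  | succ k ih =>
    obtain ⟨e, he⟩ := (Set.ncard_pos hE).1 (by omega : 0 < E(G).ncard)
    obtain ⟨x, y, hxy⟩ := Graph.exists_isLink_of_mem_edgeSet he
    have hE' : (E(G) \ {e}).Finite := hE.subset Set.sdiff_subset
    have hk : (E(G) \ {e}).ncard = k := by
      rw [Set.ncard_sdiff_singleton_of_mem he, h]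
      rfl
    have hEc : E(contract G e x y) = E(G) \ {e} := by simp [contract]
    have hVc : V(contract G e x y).Finite := by
      simp only [contract, Graph.vertexSet_map]
      exact hV.image _
    rw [hP.deletion_contraction G e x y hV hE hxy, hD.deletion_contraction G e x y hV hE hxy,
      ih (G.deleteEdges {e}) hV hE' hk, ih (contract G e x y) hVc (hEc ▸ hE') (hEc ▸ hk)]

/-- Every finite multigraph has a labelling. -/
theorem exists_labelling (G : Graph α β) (hV : V(G).Finite) (hE : E(G).Finite) :
    Nonempty (Labelling G V(G).ncard E(G).ncard) := by
  have := hV.to_subtype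
  have := hE.to_subtype
  let v : V(G) ≃ Fin V(G).ncard := Finite.equivFin V(G)
  let w : E(G) ≃ Fin E(G).ncard := Finite.equivFin E(G)
  choose a b hab using fun k => Graph.exists_isLink_of_mem_edgeSet (w.symm k).2
  exact ⟨⟨v, w, fun k => v ⟨a k, (hab k).left_mem⟩, fun k => v ⟨b k, (hab k).right_mem⟩,
    fun k => by simpa using hab k⟩⟩

/-- The power series `1 + t⁻¹ q` in `q` over `ℤ[t, t⁻¹]`. -/
def onePlus : PowerSeries ℤ[T;T⁻¹] :=
  1 + PowerSeries.C (LaurentPolynomial.T (-1)) * PowerSeries.X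

/-- The power series `1 / (1 - q)` in `q` over `ℤ[t, t⁻¹]`. -/
def geomSeries : PowerSeries ℤ[T;T⁻¹] := PowerSeries.invOfUnit (1 - PowerSeries.X) 1

theorem one_sub_mul_geomSeries : (1 - PowerSeries.X) * geomSeries = 1 :=
  PowerSeries.mul_invOfUnit _ _ (by simp)

/-- The reparametrized dichromatic polynomial
`D_G(t, q) = (1 + t⁻¹ q) ^ m * P_G(q, (1 + t⁻¹ q) / (1 - q))`, where `m` is the number of edges,
as a power series in `q` over `ℤ[t, t⁻¹]`. -/
def reparamDichromatic (G : Graph α β) : PowerSeries ℤ[T;T⁻¹] :=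
  onePlus ^ E(G).ncard *
    MvPolynomial.aeval ![PowerSeries.X, onePlus * geomSeries] (dichromatic G)

end KoszulGraph

end

noncomputable section

namespace KoszulGraph

/-! ### Monomial isomorphisms of double complexes -/

/-! Invariance. All choices in the construction affect the bicomplex only by a change of basis that
permutes basis elements up to sign and renames the variables (`SignedIso`). Reversing the ends of an
edge is absorbed by one sign, and exchanging tensor factors by the Koszul sign of both gradings.
Such a change of basis induces an isomorphism on row cohomology that commutes with the vertical
maps, so the two complexes are isomorphic, which is more than homotopy equivalent
(`Labelling.nonempty_signedIso`, `SignedIso.cohomologyComplexIso`).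

Euler characteristic. Only dimensions matter, so the vertical maps may be ignored. Horizontally an
edge complex is the Koszul complex of `0` in row `0`, plus the Koszul complex of `x_i - x_j` in row
`-1` with its `q`-degree raised by one. This gives a deletion-contraction rule (`eulerCoeff_edge`).
A vertex complex is again the Koszul complex of `0`, so after expanding all edges there remain, one
for each edge set `s`, the Koszul complexes of lists of `m + n` differences `x_i - x_j`, some of
them zero.

Their cohomology is computed one difference at a time (`exists_cohomologyBasis`). It is free over
the polynomial ring in one variable per class of the relation generated by the pairs. If a new pair
joins two classes, its difference is regular on the cohomology, which is then divided by it. If the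
pair lies in one class, multiplication by its difference is null-homotopic and the basis doubles,
contributing a factor `1 + t⁻¹ q`. The series is therefore `(1 + t⁻¹ q) ^ c / (1 - q) ^ k` with `k`
classes and `c` redundant pairs.

Counting pairs gives `k + (m + n) = n + c`, that is `c = k + m`. Summing `(-q) ^ |s| (1 + t⁻¹ q) ^
(m + k(s)) / (1 - q) ^ k(s)` over `s` yields the reparametrized dichromatic polynomial
(`onePlus_pow_mul_eulerSeries`, `Labelling.reparamDichromatic_eq`). -/

/-- A sign, as an element of `R`. -/
def unitSign (n : ℕ) : ℤˣ →* PolyRing n :=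
  (Int.castRingHom (PolyRing n) : ℤ →* PolyRing n).comp (Units.coeHom ℤ)

theorem unitSign_mul_self {n : ℕ} (u : ℤˣ) : unitSign n u * unitSign n u = 1 := by
  rw [← map_mul, Int.units_mul_self, map_one]

@[simp]
theorem rename_unitSign {n : ℕ} (f : Fin n → Fin n) (u : ℤˣ) :
    MvPolynomial.rename f (unitSign n u) = unitSign n u :=
  map_intCast (MvPolynomial.rename f : PolyRing n →ₐ[ℚ] PolyRing n) _

namespace FreeBicomplex

variable {n : ℕ}

theorem sgn_apply {ι : Type} [DecidableEq ι] (deg : ι → ℤ) (i j : ι) :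
    sgn n deg i j = if i = j then unitSign n (Int.negOnePow (deg i)) else 0 :=
  Matrix.diagonal_apply _ _ _

theorem tensor_apply {ι κ : Type} [DecidableEq ι] [DecidableEq κ]
    (deg : ι → ℤ) (A : Matrix ι ι (PolyRing n)) (B : Matrix κ κ (PolyRing n)) (i j : ι) (k l : κ) :
    (A ⊗ₖ (1 : Matrix κ κ (PolyRing n)) + sgn n deg ⊗ₖ B) (i, k) (j, l) =
      (if k = l then A i j else 0) +
        (if i = j then unitSign n (Int.negOnePow (deg i)) * B k l else 0) := by
  simp only [Matrix.add_apply, Matrix.kroneckerMap_apply, Matrix.one_apply, sgn_apply]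
  split_ifs <;> simp

/-- An isomorphism of double complexes of based free modules that sends every basis element to a
basis element up to sign, and is semilinear along `xᵢ ↦ x_{ρ i}`. -/
structure SignedIso (ρ : Equiv.Perm (Fin n)) (C D : FreeBicomplex n) where
  toEquiv : C.ι ≃ D.ι
  sign : C.ι → ℤˣ
  row_eq : ∀ i, D.row (toEquiv i) = C.row i
  tdeg_eq : ∀ i, D.tdeg (toEquiv i) = C.tdeg i
  qdeg_eq : ∀ i, D.qdeg (toEquiv i) = C.qdeg i
  hor_eq : ∀ i j, D.hor (toEquiv i) (toEquiv j) =
    unitSign n (sign i * sign j) * MvPolynomial.rename ρ (C.hor i j)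
  vert_eq : ∀ i j, D.vert (toEquiv i) (toEquiv j) =
    unitSign n (sign i * sign j) * MvPolynomial.rename ρ (C.vert i j)

namespace SignedIso

/-- The identity. -/
def refl (C : FreeBicomplex n) : SignedIso (Equiv.refl _) C C where
  toEquiv := Equiv.refl _
  sign _ := 1
  row_eq _ := rfl
  tdeg_eq _ := rfl
  qdeg_eq _ := rfl
  hor_eq i j := by simp
  vert_eq i j := by simp

/-- Composition of monomial isomorphisms. -/
def trans {ρ ρ' : Equiv.Perm (Fin n)} {C D E : FreeBicomplex n} (f : SignedIso ρ C D)
    (g : SignedIso ρ' D E) : SignedIso (ρ.trans ρ') C E where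
  toEquiv := f.toEquiv.trans g.toEquiv
  sign i := f.sign i * g.sign (f.toEquiv i)
  row_eq i := (g.row_eq _).trans (f.row_eq i)
  tdeg_eq i := (g.tdeg_eq _).trans (f.tdeg_eq i)
  qdeg_eq i := (g.qdeg_eq _).trans (f.qdeg_eq i)
  hor_eq i j := by
    simp only [Equiv.trans_apply, g.hor_eq, f.hor_eq, map_mul, rename_unitSign,
      MvPolynomial.rename_rename, Equiv.coe_trans]
    ring
  vert_eq i j := by
    simp only [Equiv.trans_apply, g.vert_eq, f.vert_eq, map_mul, rename_unitSign,
      MvPolynomial.rename_rename, Equiv.coe_trans]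
    ring

/-- This serves both differentials, with `deg` the `t`-degree for `hor` and the row for `vert`. Each
summand leaves one of the two indices fixed, so the sign of that index occurs squared and drops out.
-/
theorem tensor_entry {ρ : Equiv.Perm (Fin n)} {ι ι' κ κ' : Type} [DecidableEq ι] [DecidableEq ι']
    [DecidableEq κ] [DecidableEq κ'] (e : ι ≃ ι') (e' : κ ≃ κ') (s : ι → ℤˣ) (s' : κ → ℤˣ)
    {deg : ι → ℤ} {deg' : ι' → ℤ} (hdeg : ∀ i, deg' (e i) = deg i)
    {A : Matrix ι ι (PolyRing n)} {A' : Matrix ι' ι' (PolyRing n)}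
    {B : Matrix κ κ (PolyRing n)} {B' : Matrix κ' κ' (PolyRing n)}
    (hA : ∀ i j, A' (e i) (e j) = unitSign n (s i * s j) * MvPolynomial.rename ρ (A i j))
    (hB : ∀ i j, B' (e' i) (e' j) = unitSign n (s' i * s' j) * MvPolynomial.rename ρ (B i j))
    (p q : ι × κ) :
    (A' ⊗ₖ (1 : Matrix κ' κ' (PolyRing n)) + sgn n deg' ⊗ₖ B')
        (e.prodCongr e' p) (e.prodCongr e' q) =
      unitSign n ((s p.1 * s' p.2) * (s q.1 * s' q.2)) * MvPolynomial.rename ρ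
        ((A ⊗ₖ (1 : Matrix κ κ (PolyRing n)) + sgn n deg ⊗ₖ B) p q) := by
  obtain ⟨i, k⟩ := p
  obtain ⟨j, l⟩ := q
  simp only [Equiv.prodCongr_apply, Prod.map_apply, tensor_apply, hA, hB, hdeg,
    EmbeddingLike.apply_eq_iff_eq, map_add, mul_add]
  congr 1
  · split_ifs with h
    · subst h
      rw [show s i * s' k * (s j * s' k) = (s i * s j) * (s' k * s' k) by
        simp only [mul_left_comm, mul_comm], Int.units_mul_self, mul_one]
    · simp
  · split_ifs with h
    · subst h
      rw [show s i * s' k * (s i * s' l) = (s' k * s' l) * (s i * s i) by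
        simp only [mul_left_comm, mul_comm], Int.units_mul_self, mul_one, map_mul, map_mul, rename_unitSign]
      ring
    · simp

/-- The tensor product of monomial isomorphisms. -/
def tensor {ρ : Equiv.Perm (Fin n)} {C C' D D' : FreeBicomplex n} (f : SignedIso ρ C C')
    (g : SignedIso ρ D D') : SignedIso ρ (C.tensor D) (C'.tensor D') where
  toEquiv := f.toEquiv.prodCongr g.toEquiv
  sign i := f.sign i.1 * g.sign i.2
  row_eq i := congrArg₂ (· + ·) (f.row_eq i.1) (g.row_eq i.2)
  tdeg_eq i := congrArg₂ (· + ·) (f.tdeg_eq i.1) (g.tdeg_eq i.2)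
  qdeg_eq i := congrArg₂ (· + ·) (f.qdeg_eq i.1) (g.qdeg_eq i.2)
  hor_eq := tensor_entry _ _ _ _ f.tdeg_eq f.hor_eq g.hor_eq
  vert_eq := tensor_entry _ _ _ _ f.row_eq f.vert_eq g.vert_eq

/-- The exchange of the first two factors of a threefold product. -/
def swapEquiv (α β γ : Type) : α × β × γ ≃ β × α × γ where
  toFun p := (p.2.1, p.1, p.2.2)
  invFun p := (p.2.1, p.1, p.2.2)
  left_inv _ := rfl
  right_inv _ := rfl

/-- Here `a`, `a'` are the gradings raised by the differential under consideration and `b`, `b'`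
those it preserves. Along an entry of `A` the exponent `a a' + b b'` changes by `a'` alone, which is
the sign of moving `A` past the other factor; entries of `B` behave symmetrically. -/
theorem swap_entry {ι κ μ : Type} [DecidableEq ι] [DecidableEq κ] [DecidableEq μ]
    (a b : ι → ℤ) (a' b' : κ → ℤ) (A : Matrix ι ι (PolyRing n)) (B : Matrix κ κ (PolyRing n))
    (D : Matrix μ μ (PolyRing n))
    (hA : ∀ i j, A i j ≠ 0 → a i = a j + 1 ∧ b i = b j)
    (hB : ∀ i j, B i j ≠ 0 → a' i = a' j + 1 ∧ b' i = b' j) (p q : ι × κ × μ) :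
    (B ⊗ₖ (1 : Matrix (ι × μ) (ι × μ) (PolyRing n)) +
        sgn n a' ⊗ₖ (A ⊗ₖ (1 : Matrix μ μ (PolyRing n)) + sgn n a ⊗ₖ D))
        (swapEquiv ι κ μ p) (swapEquiv ι κ μ q) =
      unitSign n (Int.negOnePow (a p.1 * a' p.2.1 + b p.1 * b' p.2.1) *
        Int.negOnePow (a q.1 * a' q.2.1 + b q.1 * b' q.2.1)) * MvPolynomial.rename (Equiv.refl _)
      ((A ⊗ₖ (1 : Matrix (κ × μ) (κ × μ) (PolyRing n)) +
        sgn n a ⊗ₖ (B ⊗ₖ (1 : Matrix μ μ (PolyRing n)) + sgn n a' ⊗ₖ D)) p q) := by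
  obtain ⟨i, k, u⟩ := p
  obtain ⟨j, l, v⟩ := q
  simp only [swapEquiv, Equiv.coe_fn_mk, tensor_apply, Equiv.coe_refl, MvPolynomial.rename_id,
    AlgHom.id_apply, Prod.mk.injEq]
  by_cases hij : i = j <;> by_cases hkl : k = l
  · subst hij hkl
    rw [Int.units_mul_self, map_one]
    -- A differential raises its grading by one, so it has no diagonal entries.
    have h1 : A i i = 0 := by
      by_contra h
      have := (hA _ _ h).1
      omega
    have h2 : B k k = 0 := by
      by_contra h
      have := (hB _ _ h).1
      omega
    simp only [h1, h2]
    simp only [ite_self, zero_add, if_true, one_mul]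
    ring
  · subst hij
    simp only [hkl, if_false, true_and, false_and, add_zero, zero_add, if_true]
    by_cases h : B k l = 0
    · simp [h]
    · obtain ⟨h1, h2⟩ := hB _ _ h
      split_ifs
      · rw [← mul_assoc, ← map_mul, ← Int.negOnePow_add, ← Int.negOnePow_add, h1, h2,
          (Int.negOnePow_eq_iff _ 0).2, Int.negOnePow_zero, map_one, one_mul]
        -- Half of the total exponent after substituting `a' k = a' l + 1` and `b' k = b' l`.
        exact ⟨a i * a' l + b i * b' l + a i, by ring⟩
      · simp
  · subst hkl
    simp only [hij, if_false, true_and, false_and, add_zero, zero_add, if_true]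
    by_cases h : A i j = 0
    · simp [h]
    · obtain ⟨h1, h2⟩ := hA _ _ h
      split_ifs
      · rw [← Int.negOnePow_add, h1, h2]
        congr 2
        rw [Int.negOnePow_eq_iff]
        exact ⟨-(a j * a' k + b j * b' k), by ring⟩
      · simp
  · simp [hij, hkl]

/-- The symmetry of the tensor product, with the Koszul signs of both differentials. -/
def swap (A B D : FreeBicomplex n) : SignedIso (Equiv.refl _)
    (A.tensor (B.tensor D)) (B.tensor (A.tensor D)) where
  toEquiv := swapEquiv _ _ _
  sign p := Int.negOnePow (A.tdeg p.1 * B.tdeg p.2.1 + A.row p.1 * B.row p.2.1)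
  row_eq _ := add_left_comm _ _ _
  tdeg_eq _ := add_left_comm _ _ _
  qdeg_eq _ := add_left_comm _ _ _
  hor_eq := swap_entry _ _ _ _ _ _ _
    (fun i j h => ⟨(A.hor_deg i j h).2.1, by simpa using (A.hor_deg i j h).1⟩)
    (fun i j h => ⟨(B.hor_deg i j h).2.1, by simpa using (B.hor_deg i j h).1⟩)
  vert_eq p q := by
    -- For the vertical differential the row takes the role of `a` and the `t`-degree that of `b`;
    -- the sign is symmetric in the two.
    rw [add_comm (A.tdeg p.1 * _), add_comm (A.tdeg q.1 * _)]
    exact swap_entry _ _ _ _ _ _ _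
      (fun i j h => ⟨(A.vert_deg i j h).1, by simpa using (A.vert_deg i j h).2.1⟩)
      (fun i j h => ⟨(B.vert_deg i j h).1, by simpa using (B.vert_deg i j h).2.1⟩) p q

theorem zero_entry {ι ι' : Type} (ρ : Equiv.Perm (Fin n)) (e : ι → ι') (s : ι → ℤˣ) (i j : ι) :
    (0 : Matrix ι' ι' (PolyRing n)) (e i) (e j) = unitSign n (s i * s j) *
      MvPolynomial.rename ρ ((0 : Matrix ι ι (PolyRing n)) i j) := by
  simp

theorem tensorList_forall₂ {ρ : Equiv.Perm (Fin n)} {l l' : List (FreeBicomplex n)}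
    (h : List.Forall₂ (fun C D => Nonempty (SignedIso ρ C D)) l l') :
    Nonempty (SignedIso ρ (tensorList l) (tensorList l')) := by
  induction h with
  | nil => exact ⟨⟨Equiv.refl _, fun _ => 1, fun _ => rfl, fun _ => rfl, fun _ => rfl,
      zero_entry _ _ _, zero_entry _ _ _⟩⟩
  | cons h _ ih =>
    obtain ⟨f⟩ := h
    obtain ⟨g⟩ := ih
    exact ⟨f.tensor g⟩

theorem tensorList_perm {l l' : List (FreeBicomplex n)} (h : l.Perm l') :
    Nonempty (SignedIso (Equiv.refl _) (tensorList l) (tensorList l')) := by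
  induction h with
  | nil => exact ⟨refl _⟩
  | cons C _ ih => exact ih.map fun f => (refl C).tensor f
  | swap C D l => exact ⟨swap D C (tensorList l)⟩
  -- The ascription works because composing two identity permutations is definitionally the
  -- identity.
  | trans _ _ ih ih' => exact ih.elim fun f => ih'.map fun g =>
      (f.trans g : SignedIso ((Equiv.refl (Fin n)).trans (Equiv.refl (Fin n))) _ _)

theorem single_entry {ι : Type} [DecidableEq ι] (ρ : Equiv.Perm (Fin n)) (a b : ι) (i j : Fin n)
    (p q : ι) :
    Matrix.single a b (MvPolynomial.X (ρ i) - MvPolynomial.X (ρ j) : PolyRing n) p q =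
      unitSign n (1 * 1) * MvPolynomial.rename ρ
        (Matrix.single a b (MvPolynomial.X i - MvPolynomial.X j : PolyRing n) p q) := by
  simp only [Matrix.single_apply]
  split_ifs <;> simp

/-- The sign `-1` on the source `b` of the only possible nonzero entry turns `x_i - x_j` into `x_j -
x_i`; `a ≠ b` keeps the target unflipped. In an edge complex both differentials start at `(true,
true)`, so one choice of signs corrects both. -/
theorem single_entry_symm {ι : Type} [DecidableEq ι] (a b : ι) (hab : a ≠ b) (i j : Fin n)
    (p q : ι) :
    Matrix.single a b (MvPolynomial.X j - MvPolynomial.X i : PolyRing n) p q =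
      unitSign n ((if p = b then -1 else 1) * (if q = b then -1 else 1)) *
        MvPolynomial.rename (Equiv.refl (Fin n))
          (Matrix.single a b (MvPolynomial.X i - MvPolynomial.X j : PolyRing n) p q) := by
  simp only [Matrix.single_apply]
  by_cases h : a = p ∧ b = q
  · obtain ⟨rfl, rfl⟩ := h
    simp [hab, unitSign]
  · simp [h]

/-- The complexes of an edge whose ends are permuted with the variables. -/
def edgeFactor (ρ : Equiv.Perm (Fin n)) (i j : Fin n) :
    SignedIso ρ (FreeBicomplex.edgeFactor i j) (FreeBicomplex.edgeFactor (ρ i) (ρ j)) where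
  toEquiv := Equiv.refl _
  sign _ := 1
  row_eq _ := rfl
  tdeg_eq _ := rfl
  qdeg_eq _ := rfl
  hor_eq := single_entry _ _ _ _ _
  vert_eq := single_entry _ _ _ _ _

/-- The exchange of the two ends of an edge. -/
def edgeFactorSymm (i j : Fin n) : SignedIso (Equiv.refl _)
    (FreeBicomplex.edgeFactor i j) (FreeBicomplex.edgeFactor j i) where
  toEquiv := Equiv.refl _
  sign := fun p : Bool × Bool => if p = (true, true) then -1 else 1
  row_eq _ := rfl
  tdeg_eq _ := rfl
  qdeg_eq _ := rfl
  hor_eq := single_entry_symm (ι := Bool × Bool) (true, false) (true, true) (by decide) _ _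
  vert_eq := single_entry_symm (ι := Bool × Bool) (false, true) (true, true) (by decide) _ _

/-- The complexes of the vertices. -/
def vertexFactor (ρ : Equiv.Perm (Fin n)) :
    SignedIso ρ (FreeBicomplex.vertexFactor n) (FreeBicomplex.vertexFactor n) where
  toEquiv := Equiv.refl _
  sign _ := 1
  row_eq _ := rfl
  tdeg_eq _ := rfl
  qdeg_eq _ := rfl
  hor_eq := zero_entry _ id _
  vert_eq := zero_entry _ id _

end SignedIso

end FreeBicomplex

/-! ### The induced isomorphisms of cohomology -/

namespace FreeBicomplex

variable {n : ℕ}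

theorem cohomologyComplex_d (C : FreeBicomplex n) (j : ℤ) :
    C.cohomologyComplex.d j (j + 1) =
      BigradedModule.Hom.mk (C.cohomologyMap j) fun _ _ hx => C.cohomologyMap_mem j hx :=
  CochainComplex.of_d C.cohomologyModule
    (fun j => BigradedModule.Hom.mk (C.cohomologyMap j) fun _ _ hx => C.cohomologyMap_mem j hx) j

namespace SignedIso

variable {ρ : Equiv.Perm (Fin n)} {C D : FreeBicomplex n}

theorem symm_entry {ι ι' : Type} (e : ι ≃ ι') (s : ι → ℤˣ)
    {A : Matrix ι ι (PolyRing n)} {A' : Matrix ι' ι' (PolyRing n)}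
    (hA : ∀ i j, A' (e i) (e j) = unitSign n (s i * s j) * MvPolynomial.rename ρ (A i j))
    (i j : ι') :
    A (e.symm i) (e.symm j) =
      unitSign n (s (e.symm i) * s (e.symm j)) * MvPolynomial.rename ρ.symm (A' i j) := by
  have h := hA (e.symm i) (e.symm j)
  rw [e.apply_symm_apply, e.apply_symm_apply] at h
  rw [h, map_mul (MvPolynomial.rename ρ.symm), rename_unitSign, ← mul_assoc, unitSign_mul_self,
    one_mul,
    MvPolynomial.rename_rename, Equiv.symm_comp_self, MvPolynomial.rename_id, AlgHom.id_apply]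

/-- The inverse of a monomial isomorphism. -/
def symm (f : SignedIso ρ C D) : SignedIso ρ.symm D C where
  toEquiv := f.toEquiv.symm
  sign i := f.sign (f.toEquiv.symm i)
  row_eq i := by rw [← f.row_eq, f.toEquiv.apply_symm_apply]
  tdeg_eq i := by rw [← f.tdeg_eq, f.toEquiv.apply_symm_apply]
  qdeg_eq i := by rw [← f.qdeg_eq, f.toEquiv.apply_symm_apply]
  hor_eq := symm_entry _ _ f.hor_eq
  vert_eq := symm_entry _ _ f.vert_eq

/-- The semilinear map of free modules given by a monomial isomorphism. -/
def toMap (f : SignedIso ρ C D) :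
    (C.ι → PolyRing n) →ₛₗ[BigradedModule.permuteVars ρ] (D.ι → PolyRing n) where
  toFun v k := unitSign n (f.sign (f.toEquiv.symm k)) *
    MvPolynomial.rename ρ (v (f.toEquiv.symm k))
  map_add' v w := by
    ext1 k
    simp only [Pi.add_apply, map_add, mul_add]
  map_smul' c v := by
    ext1 k
    simp only [Pi.smul_apply, smul_eq_mul, map_mul]
    exact mul_left_comm _ _ _

theorem toMap_apply (f : SignedIso ρ C D) (v : C.ι → PolyRing n) (i : C.ι) :
    f.toMap v (f.toEquiv i) = unitSign n (f.sign i) * MvPolynomial.rename ρ (v i) := by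
  simp [toMap]

theorem symm_toMap (f : SignedIso ρ C D) (v : C.ι → PolyRing n) :
    f.symm.toMap (f.toMap v) = v := by
  ext1 i
  change unitSign n (f.sign (f.toEquiv.symm (f.toEquiv i))) * MvPolynomial.rename ρ.symm
    (f.toMap v (f.toEquiv i)) = v i
  rw [f.toMap_apply, f.toEquiv.symm_apply_apply, map_mul, rename_unitSign, ← mul_assoc,
    unitSign_mul_self, one_mul, MvPolynomial.rename_rename, Equiv.symm_comp_self,
    MvPolynomial.rename_id, AlgHom.id_apply]

theorem toMap_symm (f : SignedIso ρ C D) (v : D.ι → PolyRing n) :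
    f.toMap (f.symm.toMap v) = v := by
  ext1 k
  obtain ⟨i, rfl⟩ := f.toEquiv.surjective k
  have h : f.symm.toMap v i = unitSign n (f.sign (f.toEquiv.symm (f.toEquiv i))) *
    MvPolynomial.rename ρ.symm (v (f.toEquiv i)) := rfl
  rw [f.toMap_apply, h, f.toEquiv.symm_apply_apply, map_mul, rename_unitSign, ← mul_assoc,
    unitSign_mul_self, one_mul, MvPolynomial.rename_rename, Equiv.self_comp_symm,
    MvPolynomial.rename_id, AlgHom.id_apply]

theorem toMap_mulVec (f : SignedIso ρ C D) {A : Matrix C.ι C.ι (PolyRing n)}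
    {A' : Matrix D.ι D.ι (PolyRing n)}
    (hA : ∀ i j, A' (f.toEquiv i) (f.toEquiv j) =
      unitSign n (f.sign i * f.sign j) * MvPolynomial.rename ρ (A i j))
    (v : C.ι → PolyRing n) : A'.mulVec (f.toMap v) = f.toMap (A.mulVec v) := by
  ext1 k
  obtain ⟨i, rfl⟩ := f.toEquiv.surjective k
  rw [f.toMap_apply, Matrix.mulVec, dotProduct, ← f.toEquiv.sum_comp, Matrix.mulVec, dotProduct,
    map_sum, Finset.mul_sum]
  refine Finset.sum_congr rfl fun j _ => ?_
  rw [hA, f.toMap_apply, map_mul, map_mul]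
  linear_combination (unitSign n (f.sign i) * MvPolynomial.rename ρ (A i j) *
    MvPolynomial.rename ρ (v j)) * unitSign_mul_self (n := n) (f.sign j)

theorem toMap_mem_rowModule (f : SignedIso ρ C D) {j : ℤ} {v : C.ι → PolyRing n}
    (hv : v ∈ C.rowModule j) : f.toMap v ∈ D.rowModule j := by
  intro k hk
  obtain ⟨i, rfl⟩ := f.toEquiv.surjective k
  rw [f.row_eq] at hk
  rw [f.toMap_apply, hv i hk, map_zero, mul_zero]

theorem toMap_mem_homog (f : SignedIso ρ C D) {p : ℤ × ℤ} {v : C.ι → PolyRing n}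
    (hv : v ∈ C.homog p) : f.toMap v ∈ D.homog p := by
  intro k hk
  obtain ⟨i, rfl⟩ := f.toEquiv.surjective k
  rw [f.toMap_apply] at hk ⊢
  obtain ⟨a, d, hd, hq⟩ := hv i fun h => hk (by rw [h, map_zero, mul_zero])
  refine ⟨by rw [f.tdeg_eq, a], d, ?_, by rw [f.qdeg_eq, hq]⟩
  have h0 : (unitSign n (f.sign i)).IsHomogeneous 0 := by
    have : unitSign n (f.sign i) = MvPolynomial.C ((f.sign i : ℤ) : ℚ) :=
      (map_intCast (MvPolynomial.C : ℚ →+* PolyRing n) _).symm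
    rw [this]
    exact MvPolynomial.isHomogeneous_C _ _
  simpa using h0.mul hd.rename_isHomogeneous

theorem toMap_mem_cocycles (f : SignedIso ρ C D) {j : ℤ} {v : C.ι → PolyRing n}
    (hv : v ∈ C.cocycles j) : f.toMap v ∈ D.cocycles j := by
  have h0 : C.hor.mulVec v = 0 := hv.2
  refine ⟨f.toMap_mem_rowModule hv.1, ?_⟩
  change D.hor.mulVec (f.toMap v) = 0
  rw [f.toMap_mulVec f.hor_eq, h0, map_zero]

theorem toMap_mem_coboundaries (f : SignedIso ρ C D) {j : ℤ} {v : C.ι → PolyRing n}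
    (hv : v ∈ C.coboundaries j) : f.toMap v ∈ D.coboundaries j := by
  obtain ⟨w, hw, rfl⟩ := hv
  exact ⟨f.toMap w, f.toMap_mem_rowModule hw, f.toMap_mulVec f.hor_eq w⟩

/-- The map of cocycles given by a monomial isomorphism. -/
def cocyclesMap (f : SignedIso ρ C D) (j : ℤ) :
    C.cocycles j →ₛₗ[BigradedModule.permuteVars ρ] D.cocycles j where
  toFun v := ⟨f.toMap v, f.toMap_mem_cocycles v.2⟩
  map_add' _ _ := Subtype.ext (map_add f.toMap _ _)
  map_smul' _ _ := Subtype.ext (f.toMap.map_smulₛₗ _ _)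

/-- The map of cohomology given by a monomial isomorphism. -/
def cohomologyMap (f : SignedIso ρ C D) (j : ℤ) :
    C.Cohomology j →ₛₗ[BigradedModule.permuteVars ρ] D.Cohomology j :=
  Submodule.mapQ _ _ (f.cocyclesMap j) fun _ hv => f.toMap_mem_coboundaries hv

theorem cohomologyMap_mem (f : SignedIso ρ C D) (j : ℤ) {p : ℤ × ℤ} {x : C.Cohomology j}
    (hx : x ∈ C.cohomologyPiece j p) : f.cohomologyMap j x ∈ D.cohomologyPiece j p := by
  obtain ⟨v, hv, rfl⟩ := hx
  exact ⟨f.cocyclesMap j v, f.toMap_mem_homog hv, rfl⟩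

theorem symm_cohomologyMap (f : SignedIso ρ C D) (j : ℤ) (x : C.Cohomology j) :
    f.symm.cohomologyMap j (f.cohomologyMap j x) = x := by
  obtain ⟨v, rfl⟩ := Submodule.mkQ_surjective _ x
  exact congrArg Submodule.Quotient.mk (Subtype.ext (f.symm_toMap v))

theorem cohomologyMap_symm (f : SignedIso ρ C D) (j : ℤ) (x : D.Cohomology j) :
    f.cohomologyMap j (f.symm.cohomologyMap j x) = x := by
  obtain ⟨v, rfl⟩ := Submodule.mkQ_surjective _ x
  exact congrArg Submodule.Quotient.mk (Subtype.ext (f.toMap_symm v))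

/-- The isomorphism of bigraded modules given by a monomial isomorphism. -/
def cohomologyIso (f : SignedIso ρ C D) (j : ℤ) :
    C.cohomologyModule j ≅ (BigradedModule.permute ρ).obj (D.cohomologyModule j) where
  hom :=
    { toLin :=
        { toFun := fun x : C.Cohomology j => (f.cohomologyMap j x : D.Cohomology j)
          map_add' := map_add (f.cohomologyMap j)
          map_smul' := fun c x => (f.cohomologyMap j).map_smulₛₗ c x }
      map_mem := fun _ _ hx => f.cohomologyMap_mem j hx }
  inv :=
    { toLin :=
        { toFun := fun x : D.Cohomology j => (f.symm.cohomologyMap j x : C.Cohomology j)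
          map_add' := map_add (f.symm.cohomologyMap j)
          map_smul' := fun c x => by
            -- On the permuted module `c` acts through `permuteVars ρ`, and the semilinearity of the
            -- inverse along `ρ.symm` undoes this.
            have h : BigradedModule.permuteVars ρ.symm (BigradedModule.permuteVars ρ c) = c := by
              change MvPolynomial.rename ρ.symm (MvPolynomial.rename ρ c) = c
              rw [MvPolynomial.rename_rename, Equiv.symm_comp_self, MvPolynomial.rename_id,
                AlgHom.id_apply]
            have h2 := (f.symm.cohomologyMap j).map_smulₛₗ (BigradedModule.permuteVars ρ c) x
            rw [h] at h2
            exact h2 }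
      map_mem := fun _ _ hx => f.symm.cohomologyMap_mem j hx }
  hom_inv_id := BigradedModule.hom_ext (LinearMap.ext fun x => f.symm_cohomologyMap j x)
  inv_hom_id := BigradedModule.hom_ext (LinearMap.ext fun x => f.cohomologyMap_symm j x)

theorem cohomologyMap_comm (f : SignedIso ρ C D) (j : ℤ) (x : C.Cohomology j) :
    D.cohomologyMap j (f.cohomologyMap j x) =
      f.cohomologyMap (j + 1) (C.cohomologyMap j x) := by
  obtain ⟨v, rfl⟩ := Submodule.mkQ_surjective _ x
  exact congrArg Submodule.Quotient.mk (Subtype.ext (f.toMap_mulVec f.vert_eq v))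

/-- The isomorphism of complexes of bigraded modules given by a monomial isomorphism. -/
def cohomologyComplexIso (f : SignedIso ρ C D) :
    C.cohomologyComplex ≅ ((BigradedModule.permute ρ).mapHomologicalComplex
      (ComplexShape.up ℤ)).obj D.cohomologyComplex :=
  HomologicalComplex.Hom.isoOfComponents (fun j => f.cohomologyIso j) (by
    rintro i j rfl
    change _ ≫ (BigradedModule.permute ρ).map (D.cohomologyComplex.d i (i + 1)) =
      C.cohomologyComplex.d i (i + 1) ≫ _
    rw [cohomologyComplex_d, cohomologyComplex_d]
    exact BigradedModule.hom_ext (LinearMap.ext fun x => f.cohomologyMap_comm i x))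

end SignedIso

end FreeBicomplex

/-! ### Independence of the labelling and of the isomorphism type. -/

namespace Labelling

variable {α β α' β' : Type*} {G : Graph α β} {G' : Graph α' β'} {n m : ℕ}

/-- The permutation of the variables given by an isomorphism and two labellings. -/
def vertexPerm (φ : GraphIso G G') (L : Labelling G n m) (L' : Labelling G' n m) :
    Equiv.Perm (Fin n) :=
  L.vertex.symm.trans (φ.vertexEquiv.trans L'.vertex)

/-- An edge determines its ends only up to order, hence the two cases; the second is where
`edgeFactorSymm` is needed. -/
theorem ends_eq (φ : GraphIso G G') (L : Labelling G n m) (L' : Labelling G' n m) (k k' : Fin m)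
    (hk : φ.edgeEquiv (L.edge.symm k) = L'.edge.symm k') :
    (vertexPerm φ L L' (L.fst k) = L'.fst k' ∧ vertexPerm φ L L' (L.snd k) = L'.snd k') ∨
      (vertexPerm φ L L' (L.fst k) = L'.snd k' ∧ vertexPerm φ L L' (L.snd k) = L'.fst k') := by
  have h1 := (φ.isLink_iff _ _ _).2 (L.isLink k)
  rw [hk] at h1
  have key : ∀ (x : Fin n) (y : Fin n),
      (φ.vertexEquiv (L.vertex.symm x) : α') = L'.vertex.symm y → vertexPerm φ L L' x = y := by
    intro x y h
    have := Subtype.ext h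
    simp [vertexPerm, this]
  rcases h1.eq_and_eq_or_eq_and_eq (L'.isLink k') with ⟨h2, h3⟩ | ⟨h2, h3⟩
  · exact Or.inl ⟨key _ _ h2, key _ _ h3⟩
  · exact Or.inr ⟨key _ _ h2, key _ _ h3⟩

/-- The comparison has two stages: factor by factor in the edge order of `L`, renaming variables and
reversing ends where necessary, then a reordering of the edge factors by `π`. Vertex factors are all
equal and need no reordering. -/
theorem nonempty_signedIso (φ : GraphIso G G') (L : Labelling G n m) (L' : Labelling G' n m) :
    Nonempty (FreeBicomplex.SignedIso (vertexPerm φ L L') L.bicomplex L'.bicomplex) := by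
  set π : Equiv.Perm (Fin m) := L.edge.symm.trans (φ.edgeEquiv.trans L'.edge) with hπ
  have h1 : Nonempty (FreeBicomplex.SignedIso (vertexPerm φ L L') L.bicomplex
      (FreeBicomplex.tensorList (List.ofFn (fun k : Fin m =>
        FreeBicomplex.edgeFactor (L'.fst (π k)) (L'.snd (π k))) ++
          List.ofFn (fun _ : Fin n => FreeBicomplex.vertexFactor n)))) := by
    refine FreeBicomplex.SignedIso.tensorList_forall₂ (List.rel_append ?_ ?_)
    · rw [List.forall₂_iff_get]
      refine ⟨by simp, fun i h h' => ?_⟩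
      simp only [List.get_eq_getElem, List.getElem_ofFn]
      rcases ends_eq φ L L' ⟨i, by simpa using h⟩ (π ⟨i, by simpa using h⟩) (by simp [hπ])
        with ⟨h2, h3⟩ | ⟨h2, h3⟩
      · rw [← h2, ← h3]
        exact ⟨FreeBicomplex.SignedIso.edgeFactor _ _ _⟩
      · rw [← h2, ← h3]
        exact ⟨((FreeBicomplex.SignedIso.edgeFactor _ _ _).trans
          (FreeBicomplex.SignedIso.edgeFactorSymm _ _) :
            FreeBicomplex.SignedIso ((vertexPerm φ L L').trans (Equiv.refl (Fin n))) _ _)⟩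
    · rw [List.forall₂_iff_get]
      refine ⟨rfl, fun i h h' => ?_⟩
      simp only [List.get_eq_getElem, List.getElem_ofFn]
      exact ⟨FreeBicomplex.SignedIso.vertexFactor _⟩
  obtain ⟨f⟩ := h1
  obtain ⟨g⟩ := FreeBicomplex.SignedIso.tensorList_perm (List.Perm.append_right
    (List.ofFn (fun _ : Fin n => FreeBicomplex.vertexFactor n)) (Equiv.Perm.ofFn_comp_perm π
      (fun k : Fin m => FreeBicomplex.edgeFactor (L'.fst k) (L'.snd k))))
  exact ⟨(f.trans g :
    FreeBicomplex.SignedIso ((vertexPerm φ L L').trans (Equiv.refl (Fin n))) _ _)⟩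

end Labelling

/-! ### Dimensions of the homogeneous parts -/

namespace FreeBicomplex

variable {n : ℕ}

section Pieces

variable (C : FreeBicomplex n) (j : ℤ) (p : ℤ × ℤ)

/-- The horizontal differential as a `ℚ`-linear map. -/
def horRat : (C.ι → PolyRing n) →ₗ[ℚ] (C.ι → PolyRing n) := C.hor.mulVecLin.restrictScalars ℚ

@[simp]
theorem horRat_apply (v : C.ι → PolyRing n) : C.horRat v = C.hor.mulVec v := rfl

/-- The term of row `j` and bidegree `p`. -/
def rowPiece : Submodule ℚ (C.ι → PolyRing n) := (C.rowModule j).restrictScalars ℚ ⊓ C.homog p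

theorem mem_rowPiece {v : C.ι → PolyRing n} :
    v ∈ C.rowPiece j p ↔ v ∈ C.rowModule j ∧ v ∈ C.homog p := Iff.rfl

/-- The cocycles of row `j` and bidegree `p`. -/
def cocyclesPiece : Submodule ℚ (C.ι → PolyRing n) :=
  C.rowPiece j p ⊓ LinearMap.ker C.horRat

theorem mem_cocyclesPiece {v : C.ι → PolyRing n} :
    v ∈ C.cocyclesPiece j p ↔ v ∈ C.cocycles j ∧ v ∈ C.homog p :=
  ⟨fun h => ⟨⟨h.1.1, h.2⟩, h.1.2⟩, fun h => ⟨⟨h.1.1, h.2⟩, h.1.2⟩⟩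

/-- The coboundaries of row `j` and bidegree `p`. -/
def coboundariesPiece : Submodule ℚ (C.ι → PolyRing n) :=
  (C.rowPiece j (p.1 - 1, p.2)).map C.horRat

/-- A homogeneous coboundary has a homogeneous primitive: projection to a bidegree commutes with the
differential, so any primitive may be projected to bidegree `(p.1 - 1, p.2)`. -/
theorem mem_coboundariesPiece {v : C.ι → PolyRing n} :
    v ∈ C.coboundariesPiece j p ↔ v ∈ C.coboundaries j ∧ v ∈ C.homog p := by
  constructor
  · rintro ⟨w, ⟨hw, hw'⟩, rfl⟩
    refine ⟨⟨w, hw, rfl⟩, ?_⟩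
    have := C.mulVec_proj C.hor_deg (p.1 - 1, p.2) w
    rw [C.proj_of_mem hw', sub_add_cancel] at this
    rw [horRat_apply, this]
    exact C.proj_mem_homog _ _
  · rintro ⟨⟨w, hw, rfl⟩, hv⟩
    refine ⟨C.proj (p.1 - 1, p.2) w, ⟨C.proj_mem_rowModule _ hw, C.proj_mem_homog _ _⟩, ?_⟩
    rw [horRat_apply, C.mulVec_proj C.hor_deg, sub_add_cancel]
    exact C.proj_of_mem hv

theorem coboundariesPiece_le : C.coboundariesPiece j p ≤ C.cocyclesPiece j p := by
  intro v hv
  rw [mem_coboundariesPiece] at hv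
  exact (C.mem_cocyclesPiece j p).2 ⟨C.coboundaries_le_cocycles j hv.1, hv.2⟩

instance finiteDimensional_homog : FiniteDimensional ℚ (C.homog p) := by
  have : ∀ d, FiniteDimensional ℚ (MvPolynomial.homogeneousSubmodule (Fin n) ℚ d) := fun d =>
    Module.Finite.iff_fg.2 (MvPolynomial.homogeneousSubmodule_fg (Fin n) ℚ d)
  -- When `p.2 < C.qdeg i` the truncated degree is `0`, but then the entry at `i` vanishes and still
  -- belongs to the submodule.
  let φ : C.homog p →ₗ[ℚ] ((i : C.ι) → MvPolynomial.homogeneousSubmodule (Fin n) ℚ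
      (p.2 - C.qdeg i).toNat) :=
    { toFun := fun v i => ⟨v.1 i, by
        by_cases h : v.1 i = 0
        · rw [h]
          exact zero_mem _
        · obtain ⟨-, d, hd, hq⟩ := v.2 i h
          rw [show (p.2 - C.qdeg i).toNat = d by omega]
          exact hd⟩
      map_add' := fun _ _ => rfl
      map_smul' := fun _ _ => rfl }
  refine Module.Finite.of_injective φ fun v w h => ?_
  ext1
  ext1 i
  exact congrArg Subtype.val (congrFun h i)

instance : FiniteDimensional ℚ (C.rowPiece j p) :=
  Submodule.finiteDimensional_of_le (inf_le_right : C.rowPiece j p ≤ C.homog p)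

instance : FiniteDimensional ℚ (C.cocyclesPiece j p) :=
  Submodule.finiteDimensional_of_le (inf_le_left : C.cocyclesPiece j p ≤ C.rowPiece j p)

/-- The class of a homogeneous cocycle. -/
def classMap : C.cocyclesPiece j p →ₗ[ℚ] C.cohomologyPiece j p where
  toFun v := ⟨Submodule.Quotient.mk ⟨v.1, ((C.mem_cocyclesPiece j p).1 v.2).1⟩,
    _, ((C.mem_cocyclesPiece j p).1 v.2).2, rfl⟩
  map_add' _ _ := rfl
  map_smul' _ _ := rfl

theorem classMap_surjective : Function.Surjective (C.classMap j p) := by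
  rintro ⟨_, f, hf, rfl⟩
  exact ⟨⟨f.1, (C.mem_cocyclesPiece j p).2 ⟨f.2, hf⟩⟩, rfl⟩

theorem classMap_eq_zero_iff (v : C.cocyclesPiece j p) :
    C.classMap j p v = 0 ↔ (v : C.ι → PolyRing n) ∈ C.coboundaries j := by
  rw [Subtype.ext_iff]
  exact Submodule.Quotient.mk_eq_zero _

theorem ker_classMap :
    LinearMap.ker (C.classMap j p) = (C.coboundariesPiece j p).submoduleOf (C.cocyclesPiece j p) := by
  ext v
  rw [LinearMap.mem_ker, classMap_eq_zero_iff]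
  exact ⟨fun h => (C.mem_coboundariesPiece j p).2 ⟨h, v.2.1.2⟩,
    fun h => ((C.mem_coboundariesPiece j p).1 h).1⟩

instance finiteDimensional_cohomologyPiece : FiniteDimensional ℚ (C.cohomologyPiece j p) :=
  Module.Finite.of_surjective _ (C.classMap_surjective j p)

/-- The additive form avoids natural-number subtraction; dimension identities for cocycles and
coboundaries then give those for cohomology by linear arithmetic. -/
theorem finrank_cohomologyPiece_add :
    Module.finrank ℚ (C.cohomologyPiece j p) + Module.finrank ℚ (C.coboundariesPiece j p) =
      Module.finrank ℚ (C.cocyclesPiece j p) := by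
  rw [← LinearMap.finrank_range_add_finrank_ker (C.classMap j p), ker_classMap,
    LinearMap.range_eq_top.2 (C.classMap_surjective j p), finrank_top,
    (Submodule.submoduleOfEquivOfLe (C.coboundariesPiece_le j p)).finrank_eq]

end Pieces

theorem rowModule_eq_bot (C : FreeBicomplex n) {j : ℤ} (h : ∀ i, C.row i ≠ j) :
    C.rowModule j = ⊥ :=
  (Submodule.eq_bot_iff _).2 fun _ hv => funext fun i => hv i (h i)

theorem subsingleton_cohomology (C : FreeBicomplex n) {j : ℤ} (h : ∀ i, C.row i ≠ j) :
    Subsingleton (C.Cohomology j) := by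
  have : Subsingleton (C.cocycles j) := by
    rw [Submodule.subsingleton_iff_eq_bot, cocycles, C.rowModule_eq_bot h, bot_inf_eq]
  exact (Submodule.mkQ_surjective _).subsingleton

theorem finrank_eq_zero_of_row (C : FreeBicomplex n) {j : ℤ} (h : ∀ i, C.row i ≠ j) (p : ℤ × ℤ) :
    Module.finrank ℚ (C.cohomologyPiece j p) = 0 := by
  have := C.subsingleton_cohomology h
  exact Module.finrank_zero_of_subsingleton

/-- The coefficient of `t ^ a * q ^ b` in the bigraded Euler characteristic. -/
def eulerCoeff (C : FreeBicomplex n) (a b : ℤ) : ℤ :=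
  ∑ᶠ j : ℤ, (Int.negOnePow j : ℤ) * (Module.finrank ℚ (C.cohomologyPiece j (a, b)) : ℤ)

theorem finite_support_eulerCoeff (C : FreeBicomplex n) (a b : ℤ) :
    (Function.support fun j : ℤ =>
      (Int.negOnePow j : ℤ) * (Module.finrank ℚ (C.cohomologyPiece j (a, b)) : ℤ)).Finite := by
  refine (Set.finite_range C.row).subset fun j hj => ?_
  by_contra h
  refine hj ?_
  change (Int.negOnePow j : ℤ) * (Module.finrank ℚ (C.cohomologyPiece j (a, b)) : ℤ) = 0
  rw [C.finrank_eq_zero_of_row (fun i hi => h ⟨i, hi⟩)]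
  simp

/-- The induced map is only semilinear over `R`, but renaming variables fixes constants, so it is
`ℚ`-linear and preserves dimensions. This allows tensor factors to be reordered when computing Euler
characteristics. -/
theorem SignedIso.eulerCoeff_eq {ρ : Equiv.Perm (Fin n)} {C D : FreeBicomplex n}
    (f : SignedIso ρ C D) (a b : ℤ) : C.eulerCoeff a b = D.eulerCoeff a b := by
  refine finsum_congr fun j => ?_
  congr 2
  have hsmul : ∀ (c : ℚ) (x : C.Cohomology j),
      f.cohomologyMap j (c • x) = c • f.cohomologyMap j x := by
    intro c x
    rw [← algebraMap_smul (PolyRing n) c x, map_smulₛₗ, ← algebraMap_smul (PolyRing n) c]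
    congr 1
    exact (MvPolynomial.rename ρ : PolyRing n →ₐ[ℚ] PolyRing n).commutes c
  refine LinearEquiv.finrank_eq (LinearEquiv.ofBijective
    ({ toFun := fun x => ⟨f.cohomologyMap j x.1, f.cohomologyMap_mem j x.2⟩
       map_add' := fun x y => Subtype.ext (map_add _ _ _)
       map_smul' := fun c x => Subtype.ext (hsmul c x) } :
      C.cohomologyPiece j (a, b) →ₗ[ℚ] D.cohomologyPiece j (a, b)) ⟨fun x y h => ?_, fun y => ?_⟩)
  · have := congrArg (fun z => f.symm.cohomologyMap j z.1) h
    simpa only [LinearMap.coe_mk, AddHom.coe_mk, symm_cohomologyMap, Subtype.ext_iff] using this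
  · exact ⟨⟨f.symm.cohomologyMap j y.1, f.symm.cohomologyMap_mem j y.2⟩,
      Subtype.ext (f.cohomologyMap_symm j y.1)⟩

/-! ### Rows of the tensor product with the complex of an edge -/

/-- The Koszul complex `0 → R{-1,1} → R → 0` of `x_i - x_j`, in row `0`. -/
def koszulFactor (i j : Fin n) : FreeBicomplex n where
  ι := Bool
  row _ := 0
  tdeg p := if p then -1 else 0
  qdeg p := if p then 1 else 0
  hor := Matrix.single false true (MvPolynomial.X i - MvPolynomial.X j)
  vert := 0
  hor_deg p p' h := by
    rw [Matrix.single_apply] at h ⊢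
    obtain ⟨⟨rfl, rfl⟩, -⟩ := ite_ne_right_iff.1 h
    exact ⟨by simp, by simp, 1, by
      simpa using (MvPolynomial.isHomogeneous_X ℚ i).sub (MvPolynomial.isHomogeneous_X ℚ j),
      by simp⟩
  vert_deg _ _ h := absurd rfl h
  hor_hor := Matrix.single_mul_single_of_ne _ _ _ _ (by decide) _
  vert_vert := mul_zero _
  hor_vert := by rw [mul_zero, zero_mul]

/-- Vertices thereby become Koszul factors of loops `(i, i)`, of the same kind as the factors
produced by edges. -/
theorem koszulFactor_self (i : Fin n) : koszulFactor i i = vertexFactor n := by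
  simp [koszulFactor, vertexFactor]

theorem tensor_mulVec {ι κ : Type} [Fintype ι] [DecidableEq ι] [Fintype κ] [DecidableEq κ]
    (deg : ι → ℤ) (A : Matrix ι ι (PolyRing n)) (B : Matrix κ κ (PolyRing n))
    (v : ι × κ → PolyRing n) (i : ι) (k : κ) :
    (A ⊗ₖ (1 : Matrix κ κ (PolyRing n)) + sgn n deg ⊗ₖ B).mulVec v (i, k) =
      (∑ j, A i j * v (j, k)) +
        unitSign n (Int.negOnePow (deg i)) * B.mulVec (fun l => v (i, l)) k := by
  rw [Matrix.mulVec, dotProduct, Fintype.sum_prod_type]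
  simp only [tensor_apply, add_mul, Finset.sum_add_distrib, ite_mul, zero_mul,
    Finset.sum_ite_eq, Finset.mem_univ, if_true, Matrix.mulVec, dotProduct, Finset.mul_sum]
  congr 1
  rw [Finset.sum_comm]
  simp [Finset.sum_ite_eq, mul_assoc]

theorem unitSign_neg_one : unitSign n (-1) = -1 := by
  simp [unitSign]

section Koszul

variable (i j : Fin n) (D : FreeBicomplex n) (v : Bool × D.ι → PolyRing n) (k : D.ι)

theorem koszulFactor_tensor_hor_true :
    ((koszulFactor i j).tensor D).hor.mulVec v (true, k) =
      - D.hor.mulVec (fun l => v (true, l)) k := by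
  refine (tensor_mulVec _ _ _ v true k).trans ?_
  simp [koszulFactor, unitSign_neg_one]

theorem koszulFactor_tensor_hor_false :
    ((koszulFactor i j).tensor D).hor.mulVec v (false, k) =
      (MvPolynomial.X i - MvPolynomial.X j) * v (true, k) +
        D.hor.mulVec (fun l => v (false, l)) k := by
  refine (tensor_mulVec _ _ _ v false k).trans ?_
  simp [koszulFactor, Matrix.single_apply]

/-- The horizontal differential never mixes the two rows of an edge complex. Row `0` behaves as the
Koszul complex of `x_i - x_i = 0`, and row `-1` in the next lemma as that of `x_i - x_j`. -/
theorem edgeFactor_tensor_hor_false (w : (Bool × Bool) × D.ι → PolyRing n) (c : Bool) :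
    ((edgeFactor i j).tensor D).hor.mulVec w ((false, c), k) =
      ((koszulFactor i i).tensor D).hor.mulVec (fun x => w ((false, x.1), x.2)) (c, k) := by
  refine (tensor_mulVec _ _ _ w (false, c) k).trans ?_
  cases c
  · refine Eq.trans ?_ (koszulFactor_tensor_hor_false i i D (fun x => w ((false, x.1), x.2)) k).symm
    simp [edgeFactor]
  · refine Eq.trans ?_ (koszulFactor_tensor_hor_true i i D (fun x => w ((false, x.1), x.2)) k).symm
    simp [edgeFactor, unitSign_neg_one]

theorem edgeFactor_tensor_hor_true (w : (Bool × Bool) × D.ι → PolyRing n) (c : Bool) :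
    ((edgeFactor i j).tensor D).hor.mulVec w ((true, c), k) =
      ((koszulFactor i j).tensor D).hor.mulVec (fun x => w ((true, x.1), x.2)) (c, k) := by
  refine (tensor_mulVec _ _ _ w (true, c) k).trans ?_
  cases c
  · refine Eq.trans ?_ (koszulFactor_tensor_hor_false i j D (fun x => w ((true, x.1), x.2)) k).symm
    simp [edgeFactor, Matrix.single_apply]
  · refine Eq.trans ?_ (koszulFactor_tensor_hor_true i j D (fun x => w ((true, x.1), x.2)) k).symm
    simp [edgeFactor, unitSign_neg_one]

/-- The basis elements of the tensor product with an edge, split into those that do and those that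
do not contract the edge. -/
def edgeSplit : (((edgeFactor i j).tensor D).ι → PolyRing n) ≃ₗ[ℚ]
    (((koszulFactor i i).tensor D).ι → PolyRing n) ×
      (((koszulFactor i j).tensor D).ι → PolyRing n) where
  toFun w := (fun x => w ((false, x.1), x.2), fun x => w ((true, x.1), x.2))
  invFun u x := if (x.1.1 : Bool) then u.2 (x.1.2, x.2) else u.1 (x.1.2, x.2)
  map_add' _ _ := rfl
  map_smul' _ _ := rfl
  left_inv w := by
    ext1 ⟨⟨c, l⟩, k⟩
    cases c <;> rfl
  right_inv _ := rfl

theorem edge_row_true (c : Bool) :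
    ((edgeFactor i j).tensor D).row ((true, c), k) + 1 =
      ((koszulFactor i j).tensor D).row (c, k) := by
  change (-1 : ℤ) + D.row k + 1 = 0 + D.row k
  ring

theorem edge_qdeg_false (c : Bool) :
    ((edgeFactor i j).tensor D).qdeg ((false, c), k) =
      ((koszulFactor i i).tensor D).qdeg (c, k) := by
  change (0 + (if c then 1 else 0) + D.qdeg k : ℤ) = (if c then 1 else 0) + D.qdeg k
  ring

theorem edge_qdeg_true (c : Bool) :
    ((edgeFactor i j).tensor D).qdeg ((true, c), k) =
      ((koszulFactor i j).tensor D).qdeg (c, k) + 1 := by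
  change (1 + (if c then 1 else 0) + D.qdeg k : ℤ) = (if c then 1 else 0) + D.qdeg k + 1
  ring

/-- The contracted part carries row `-1` and an extra `q`-degree `1`, so what lies in row `r` and
degree `p` comes from row `r + 1` and `q`-degree `p.2 - 1` of the Koszul product. -/
theorem mem_rowPiece_edge (r : ℤ) (p : ℤ × ℤ) (w : ((edgeFactor i j).tensor D).ι → PolyRing n) :
    w ∈ ((edgeFactor i j).tensor D).rowPiece r p ↔
      edgeSplit i j D w ∈ (((koszulFactor i i).tensor D).rowPiece r p).prod
        (((koszulFactor i j).tensor D).rowPiece (r + 1) (p.1, p.2 - 1)) := by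
  have shift : ∀ {x y z d : ℤ}, y = z + 1 → (x = y + d ↔ x - 1 = z + d) := by
    intro x y z d h
    omega
  rw [Submodule.mem_prod, mem_rowPiece, mem_rowPiece, mem_rowPiece]
  constructor
  · rintro ⟨h1, h2⟩
    refine ⟨⟨fun x hx => h1 ((false, x.1), x.2) hx, fun x hx => ?_⟩,
      ⟨fun x hx => h1 ((true, x.1), x.2) fun h =>
        hx ((edge_row_true i j D x.2 x.1).symm.trans (congrArg (· + 1) h)), fun x hx => ?_⟩⟩
    · obtain ⟨a, d, hd, e⟩ := h2 ((false, x.1), x.2) hx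
      exact ⟨a, d, hd, e.trans (congrArg (· + (d : ℤ)) (edge_qdeg_false i j D x.2 x.1))⟩
    · obtain ⟨a, d, hd, e⟩ := h2 ((true, x.1), x.2) hx
      exact ⟨a, d, hd, (shift (edge_qdeg_true i j D x.2 x.1)).1 e⟩
  · rintro ⟨⟨h1, h2⟩, ⟨h3, h4⟩⟩
    refine ⟨?_, ?_⟩
    · rintro ⟨⟨c, l⟩, k⟩ hx
      cases c
      · exact h1 (l, k) hx
      · exact h3 (l, k) fun h =>
          hx (add_right_cancel ((edge_row_true i j D k l).trans h))
    · rintro ⟨⟨c, l⟩, k⟩ hx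
      cases c
      · obtain ⟨a, d, hd, e⟩ := h2 (l, k) hx
        exact ⟨a, d, hd, e.trans (congrArg (· + (d : ℤ)) (edge_qdeg_false i j D k l).symm)⟩
      · obtain ⟨a, d, hd, e⟩ := h4 (l, k) hx
        exact ⟨a, d, hd, (shift (edge_qdeg_true i j D k l)).2 e⟩

theorem edgeSplit_hor (w : ((edgeFactor i j).tensor D).ι → PolyRing n) :
    edgeSplit i j D (((edgeFactor i j).tensor D).horRat w) =
      (((koszulFactor i i).tensor D).horRat (edgeSplit i j D w).1,
        ((koszulFactor i j).tensor D).horRat (edgeSplit i j D w).2) := by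
  refine Prod.ext (funext fun x => ?_) (funext fun x => ?_)
  · exact edgeFactor_tensor_hor_false i j D x.2 w x.1
  · exact edgeFactor_tensor_hor_true i j D x.2 w x.1

theorem mem_cocyclesPiece_edge (r : ℤ) (p : ℤ × ℤ) (w : ((edgeFactor i j).tensor D).ι → PolyRing n) :
    w ∈ ((edgeFactor i j).tensor D).cocyclesPiece r p ↔
      edgeSplit i j D w ∈ (((koszulFactor i i).tensor D).cocyclesPiece r p).prod
        (((koszulFactor i j).tensor D).cocyclesPiece (r + 1) (p.1, p.2 - 1)) := by
  have h1 := mem_rowPiece_edge i j D r p w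
  have h2 := edgeSplit_hor i j D w
  have h3 : ((edgeFactor i j).tensor D).horRat w = 0 ↔
      ((koszulFactor i i).tensor D).horRat (edgeSplit i j D w).1 = 0 ∧
        ((koszulFactor i j).tensor D).horRat (edgeSplit i j D w).2 = 0 := by
    rw [← Prod.mk_eq_zero, ← h2, LinearEquiv.map_eq_zero_iff]
  rw [Submodule.mem_prod] at h1 ⊢
  constructor
  · rintro ⟨h4, h5⟩
    exact ⟨⟨(h1.1 h4).1, (h3.1 h5).1⟩, ⟨(h1.1 h4).2, (h3.1 h5).2⟩⟩
  · rintro ⟨⟨h4, h5⟩, ⟨h6, h7⟩⟩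
    exact ⟨h1.2 ⟨h4, h6⟩, h3.2 ⟨h5, h7⟩⟩

theorem mem_coboundariesPiece_edge (r : ℤ) (p : ℤ × ℤ) (w : ((edgeFactor i j).tensor D).ι → PolyRing n) :
    w ∈ ((edgeFactor i j).tensor D).coboundariesPiece r p ↔
      edgeSplit i j D w ∈ (((koszulFactor i i).tensor D).coboundariesPiece r p).prod
        (((koszulFactor i j).tensor D).coboundariesPiece (r + 1) (p.1, p.2 - 1)) := by
  rw [Submodule.mem_prod]
  constructor
  · rintro ⟨u, hu, rfl⟩
    have h := (mem_rowPiece_edge i j D _ _ u).1 hu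
    have h2 := edgeSplit_hor i j D u
    exact ⟨⟨_, h.1, (congrArg Prod.fst h2).symm⟩, ⟨_, h.2, (congrArg Prod.snd h2).symm⟩⟩
  · rintro ⟨⟨u, hu, hu'⟩, ⟨u', h1, h2⟩⟩
    refine ⟨(edgeSplit i j D).symm (u, u'), (mem_rowPiece_edge i j D _ _ _).2 ?_, ?_⟩
    · rw [LinearEquiv.apply_symm_apply]
      exact ⟨hu, h1⟩
    · apply (edgeSplit i j D).injective
      refine (edgeSplit_hor i j D _).trans ?_
      rw [LinearEquiv.apply_symm_apply]
      exact Prod.ext hu' h2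

theorem finrank_eq_of_mem_prod {V V₁ V₂ : Type} [AddCommGroup V] [AddCommGroup V₁]
    [AddCommGroup V₂] [Module ℚ V] [Module ℚ V₁] [Module ℚ V₂] (e : V ≃ₗ[ℚ] V₁ × V₂)
    {S : Submodule ℚ V} {S₁ : Submodule ℚ V₁} {S₂ : Submodule ℚ V₂}
    [FiniteDimensional ℚ S₁] [FiniteDimensional ℚ S₂]
    (h : ∀ v, v ∈ S ↔ e v ∈ S₁.prod S₂) :
    Module.finrank ℚ S = Module.finrank ℚ S₁ + Module.finrank ℚ S₂ := by
  rw [← Module.finrank_prod]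
  refine LinearEquiv.finrank_eq (LinearEquiv.ofBijective
    ({ toFun := fun v => (⟨(e v).1, ((h v).1 v.2).1⟩, ⟨(e v).2, ((h v).1 v.2).2⟩)
       map_add' := fun v w => by simp
       map_smul' := fun c v => by simp } : S →ₗ[ℚ] S₁ × S₂) ⟨fun v w hvw => ?_, fun u => ?_⟩)
  · simp only [LinearMap.coe_mk, AddHom.coe_mk, Prod.mk.injEq, Subtype.mk.injEq] at hvw
    exact Subtype.ext (e.injective (Prod.ext hvw.1 hvw.2))
  · refine ⟨⟨e.symm (u.1, u.2), (h _).2 ?_⟩, ?_⟩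
    · rw [e.apply_symm_apply]
      exact ⟨u.1.2, u.2.2⟩
    · simp

instance (C : FreeBicomplex n) (r : ℤ) (p : ℤ × ℤ) :
    FiniteDimensional ℚ (C.coboundariesPiece r p) :=
  Submodule.finiteDimensional_of_le (C.coboundariesPiece_le r p)

theorem finrank_cohomologyPiece_edge (r : ℤ) (p : ℤ × ℤ) :
    Module.finrank ℚ (((edgeFactor i j).tensor D).cohomologyPiece r p) =
      Module.finrank ℚ (((koszulFactor i i).tensor D).cohomologyPiece r p) +
        Module.finrank ℚ (((koszulFactor i j).tensor D).cohomologyPiece (r + 1)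
          (p.1, p.2 - 1)) := by
  have h0 := ((edgeFactor i j).tensor D).finrank_cohomologyPiece_add r p
  have h1 := ((koszulFactor i i).tensor D).finrank_cohomologyPiece_add r p
  have h2 := ((koszulFactor i j).tensor D).finrank_cohomologyPiece_add (r + 1) (p.1, p.2 - 1)
  have h3 := finrank_eq_of_mem_prod (edgeSplit i j D) (mem_cocyclesPiece_edge i j D r p)
  have h4 := finrank_eq_of_mem_prod (edgeSplit i j D) (mem_coboundariesPiece_edge i j D r p)
  omega

/-- Deletion-contraction for Euler characteristics: the shift by one row gives the minus sign, the
shift of the `q`-degree gives the factor `q`. -/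
theorem eulerCoeff_edge (a b : ℤ) :
    ((edgeFactor i j).tensor D).eulerCoeff a b =
      ((koszulFactor i i).tensor D).eulerCoeff a b -
        ((koszulFactor i j).tensor D).eulerCoeff a (b - 1) := by
  -- Reindexing by `r ↦ r + 1` lets the two sums be compared term by term. Subtracting them needs
  -- the finiteness of both supports.
  have h : ((koszulFactor i j).tensor D).eulerCoeff a (b - 1) = ∑ᶠ r : ℤ,
      (Int.negOnePow (r + 1) : ℤ) * (Module.finrank ℚ (((koszulFactor i j).tensor D).cohomologyPiece
        (r + 1) (a, b - 1)) : ℤ) :=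
    (finsum_comp_equiv (Equiv.addRight (1 : ℤ))).symm
  have hfin := (((koszulFactor i j).tensor D).finite_support_eulerCoeff a (b - 1)).preimage
    (add_left_injective (1 : ℤ)).injOn
  rw [h, eulerCoeff, eulerCoeff, ← finsum_sub_distrib
    (((koszulFactor i i).tensor D).finite_support_eulerCoeff a b) hfin]
  refine finsum_congr fun r => ?_
  change _ = _ - (Int.negOnePow (r + 1) : ℤ) *
    (Module.finrank ℚ (((koszulFactor i j).tensor D).cohomologyPiece (r + 1) (a, b - 1)) : ℤ)
  rw [finrank_cohomologyPiece_edge, Int.negOnePow_succ]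
  push_cast
  ring

end Koszul

end FreeBicomplex

/-! ### The cohomology of Koszul complexes of differences of variables -/

/-- Given a map that sends every vertex to a representative of its class, unite the classes of `i`
and `j`. -/
def uniteClasses {V : Type*} [DecidableEq V] (φ : V → V) (i j v : V) : V :=
  if φ v = φ j then φ i else φ v

section uniteClasses

variable {V : Type*} [DecidableEq V] {φ : V → V} {i j : V}

theorem uniteClasses_idem (hφ : ∀ v, φ (φ v) = φ v) (v : V) :
    uniteClasses φ i j (uniteClasses φ i j v) = uniteClasses φ i j v := by
  unfold uniteClasses
  by_cases h : φ v = φ j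
  · simp [h, hφ]
  · simp [h, hφ]

theorem uniteClasses_of_eq (h : φ i = φ j) : uniteClasses φ i j = φ := by
  ext v
  unfold uniteClasses
  split_ifs with h'
  · rw [h, h']
  · rfl

theorem uniteClasses_ends : uniteClasses φ i j i = uniteClasses φ i j j := by
  simp [uniteClasses]

theorem uniteClasses_eq_iff (x y : V) :
    uniteClasses φ i j x = uniteClasses φ i j y ↔
      φ x = φ y ∨ (φ x = φ i ∧ φ y = φ j) ∨ (φ x = φ j ∧ φ y = φ i) ∨
        (φ x = φ j ∧ φ y = φ j) := by
  unfold uniteClasses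
  split_ifs <;> grind

end uniteClasses

/-- Modulo the differences, `x_{φ v} = x_v` because `φ` is idempotent. Hence the quotient map
factors through `rename φ` and kills its kernel. -/
theorem mem_span_of_rename_eq_zero {n : ℕ} {φ : Fin n → Fin n} (hφ : ∀ v, φ (φ v) = φ v)
    {e : PolyRing n} (he : MvPolynomial.rename φ e = 0) :
    e ∈ Ideal.span {p : PolyRing n |
      ∃ i j, φ i = φ j ∧ p = MvPolynomial.X i - MvPolynomial.X j} := by
  set I := Ideal.span {p : PolyRing n |
      ∃ i j, φ i = φ j ∧ p = MvPolynomial.X i - MvPolynomial.X j}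
  have h : (Ideal.Quotient.mkₐ ℚ I).comp (MvPolynomial.rename φ) = Ideal.Quotient.mkₐ ℚ I := by
    ext v
    simp only [AlgHom.comp_apply, MvPolynomial.rename_X]
    exact Ideal.Quotient.eq.2 (Ideal.subset_span ⟨φ v, v, hφ v, rfl⟩)
  have h2 := DFunLike.congr_fun h e
  rw [AlgHom.comp_apply, he, map_zero] at h2
  exact Ideal.Quotient.eq_zero_iff_mem.1 h2.symm

namespace FreeBicomplex

variable {n : ℕ}

/-- Multiplication by `x_i - x_j` is null-homotopic on the horizontal complex, by a homogeneous
homotopy. -/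
def NullHomotopic (K : FreeBicomplex n) (i j : Fin n) : Prop :=
  ∃ h : (K.ι → PolyRing n) →ₗ[PolyRing n] (K.ι → PolyRing n),
    (∀ v, K.hor.mulVecLin (h v) + h (K.hor.mulVecLin v) =
      (MvPolynomial.X i - MvPolynomial.X j : PolyRing n) • v) ∧
    ∀ (p : ℤ × ℤ) (v : K.ι → PolyRing n), v ∈ K.homog p → h v ∈ K.homog (p.1 - 1, p.2 + 1)

namespace NullHomotopic

variable {K : FreeBicomplex n} {i j k : Fin n}

theorem refl (K : FreeBicomplex n) (i : Fin n) : K.NullHomotopic i i :=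
  ⟨0, fun v => by simp, fun p v _ => (K.homog _).zero_mem⟩

theorem symm (h : K.NullHomotopic i j) : K.NullHomotopic j i := by
  obtain ⟨h, h1, h2⟩ := h
  refine ⟨-h, fun v => ?_, fun p v hv => (K.homog _).neg_mem (h2 p v hv)⟩
  rw [LinearMap.neg_apply, LinearMap.neg_apply, map_neg, ← neg_add, h1, ← neg_smul, neg_sub]

theorem trans (h : K.NullHomotopic i j) (h' : K.NullHomotopic j k) : K.NullHomotopic i k := by
  obtain ⟨h, h1, h2⟩ := h
  obtain ⟨h', h1', h2'⟩ := h'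
  refine ⟨h + h', fun v => ?_, fun p v hv => (K.homog _).add_mem (h2 p v hv) (h2' p v hv)⟩
  rw [LinearMap.add_apply, LinearMap.add_apply, map_add, add_add_add_comm, h1, h1', ← add_smul,
    sub_add_sub_cancel]

end NullHomotopic

/-- A homogeneous basis of the cohomology of the horizontal complex as a module over the quotient
of `R` by the kernel of `xᵢ ↦ x_{φ i}`. -/
structure CohomologyBasis (K : FreeBicomplex n) (φ : Fin n → Fin n) where
  index : Type
  [fintype : Fintype index]
  elt : index → K.ι → PolyRing n
  tdeg : index → ℤ
  qdeg : index → ℕ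
  elt_mem : ∀ z, elt z ∈ K.homog (tdeg z, qdeg z)
  hor_elt : ∀ z, K.hor.mulVecLin (elt z) = 0
  span : ∀ f, K.hor.mulVecLin f = 0 →
    ∃ (c : index → PolyRing n) (u : K.ι → PolyRing n), f = ∑ z, c z • elt z + K.hor.mulVecLin u
  indep : ∀ (c : index → PolyRing n) (u : K.ι → PolyRing n),
    ∑ z, c z • elt z = K.hor.mulVecLin u → ∀ z, MvPolynomial.rename φ (c z) = 0
  -- This makes the kernel of `rename φ` act by zero on cohomology, and it supplies the homotopy
  -- that corrects the new cocycles when a pair closes a cycle.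
  nullHomotopic : ∀ i j, φ i = φ j → K.NullHomotopic i j

attribute [instance] CohomologyBasis.fintype

/-- Pairs of vectors as vectors of the tensor product with a Koszul complex. -/
def koszulPair (i j : Fin n) (K : FreeBicomplex n) :
    ((K.ι → PolyRing n) × (K.ι → PolyRing n)) ≃ₗ[PolyRing n]
      (((koszulFactor i j).tensor K).ι → PolyRing n) where
  toFun u := fun x : Bool × K.ι => if x.1 then u.1 x.2 else u.2 x.2
  invFun v := (fun k => v (true, k), fun k => v (false, k))
  map_add' u v := by
    ext1 ⟨c, k⟩
    cases c <;> rfl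
  map_smul' c v := by
    ext1 ⟨b, k⟩
    cases b <;> rfl
  left_inv _ := rfl
  right_inv v := by
    ext1 ⟨c, k⟩
    cases c <;> rfl

section koszulPair

variable (i j : Fin n) (K : FreeBicomplex n) (f g : K.ι → PolyRing n)

/-- The product with a Koszul complex is the mapping cone of multiplication by `x_i - x_j`; the
minus sign comes from the left term sitting in `t`-degree `-1`. -/
theorem hor_koszulPair :
    ((koszulFactor i j).tensor K).hor.mulVecLin (koszulPair i j K (f, g)) =
      koszulPair i j K (-K.hor.mulVecLin f,
        (MvPolynomial.X i - MvPolynomial.X j : PolyRing n) • f + K.hor.mulVecLin g) := by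
  ext1 ⟨c, k⟩
  cases c
  · exact koszulFactor_tensor_hor_false i j K (koszulPair i j K (f, g)) k
  · exact koszulFactor_tensor_hor_true i j K (koszulPair i j K (f, g)) k

theorem sum_smul_koszulPair {κ : Type} [Fintype κ] (c : κ → PolyRing n)
    (f g : κ → K.ι → PolyRing n) :
    ∑ z, c z • koszulPair i j K (f z, g z) =
      koszulPair i j K (∑ z, c z • f z, ∑ z, c z • g z) := by
  simp only [← map_smul, ← map_sum, Prod.smul_mk]
  congr 1
  exact Prod.ext (Prod.fst_sum) (Prod.snd_sum)

theorem koszulPair_mem_homog {p : ℤ × ℤ} (hf : f ∈ K.homog (p.1 + 1, p.2 - 1))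
    (hg : g ∈ K.homog p) : koszulPair i j K (f, g) ∈ ((koszulFactor i j).tensor K).homog p := by
  rintro ⟨c, k⟩ hx
  cases c
  · obtain ⟨a, d, hd, e⟩ := hg k hx
    refine ⟨?_, d, hd, ?_⟩
    · change 0 + K.tdeg k = p.1
      rw [a, zero_add]
    · change p.2 = 0 + K.qdeg k + d
      rw [e, zero_add]
  · obtain ⟨a, d, hd, e⟩ := hf k hx
    refine ⟨?_, d, hd, ?_⟩
    · change -1 + K.tdeg k = p.1
      rw [a]
      ring
    · change p.2 = 1 + K.qdeg k + d
      change p.2 - 1 = _ at e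
      omega

theorem of_koszulPair_mem_homog {p : ℤ × ℤ}
    (h : koszulPair i j K (f, g) ∈ ((koszulFactor i j).tensor K).homog p) :
    f ∈ K.homog (p.1 + 1, p.2 - 1) ∧ g ∈ K.homog p := by
  refine ⟨fun k hk => ?_, fun k hk => ?_⟩
  · obtain ⟨a, d, hd, e⟩ := h (true, k) hk
    change -1 + K.tdeg k = p.1 at a
    change p.2 = 1 + K.qdeg k + d at e
    exact ⟨by dsimp only; omega, d, hd, by dsimp only; omega⟩
  · obtain ⟨a, d, hd, e⟩ := h (false, k) hk
    change 0 + K.tdeg k = p.1 at a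
    change p.2 = 0 + K.qdeg k + d at e
    exact ⟨by omega, d, hd, by omega⟩

/-- The homotopy is `-h` on the left component and `h` on the right one. The sign matches that of
the cone differential, so the cross terms with `x_i - x_j` cancel. -/
theorem NullHomotopic.koszulPair {K : FreeBicomplex n} {a b : Fin n} (h : K.NullHomotopic a b)
    (i j : Fin n) : ((koszulFactor i j).tensor K).NullHomotopic a b := by
  obtain ⟨h, h1, h2⟩ := h
  refine ⟨(FreeBicomplex.koszulPair i j K).conj (LinearMap.prodMap (-h) h), fun v => ?_,
    fun p v hv => ?_⟩
  · obtain ⟨⟨f, g⟩, rfl⟩ := (FreeBicomplex.koszulPair i j K).surjective v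
    simp only [LinearEquiv.conj_apply_apply, LinearEquiv.symm_apply_apply, hor_koszulPair,
      LinearMap.prodMap_apply, ← map_add, ← map_smul, Prod.mk_add_mk, Prod.smul_mk]
    congr 2
    · simp only [LinearMap.neg_apply, map_neg, neg_neg, h1]
    · rw [← h1 g, LinearMap.neg_apply, map_add, map_smul]
      module
  · obtain ⟨⟨f, g⟩, rfl⟩ := (FreeBicomplex.koszulPair i j K).surjective v
    obtain ⟨hf, hg⟩ := of_koszulPair_mem_homog i j K f g hv
    simp only [LinearEquiv.conj_apply_apply, LinearEquiv.symm_apply_apply,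
      LinearMap.prodMap_apply]
    refine koszulPair_mem_homog _ _ _ _ _ ?_ (h2 _ _ hg)
    have := h2 _ _ ((K.homog _).neg_mem hf)
    simpa [add_sub_cancel_right, sub_add_cancel] using this

/-- The homotopy is `(f, g) ↦ (g, 0)`, the standard contraction of multiplication by a Koszul
element. -/
theorem nullHomotopic_koszulFactor : ((koszulFactor i j).tensor K).NullHomotopic i j := by
  refine ⟨(FreeBicomplex.koszulPair i j K).conj
    (LinearMap.inl _ _ _ ∘ₗ LinearMap.snd _ _ _), fun v => ?_, fun p v hv => ?_⟩
  · obtain ⟨⟨f, g⟩, rfl⟩ := (FreeBicomplex.koszulPair i j K).surjective v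
    simp only [LinearEquiv.conj_apply_apply, LinearEquiv.symm_apply_apply, hor_koszulPair,
      LinearMap.comp_apply, LinearMap.inl_apply, LinearMap.snd_apply, ← map_add,
      ← map_smul, Prod.mk_add_mk, Prod.smul_mk, map_zero, add_zero]
    congr 2
    abel
  · obtain ⟨⟨f, g⟩, rfl⟩ := (FreeBicomplex.koszulPair i j K).surjective v
    obtain ⟨hf, hg⟩ := of_koszulPair_mem_homog i j K f g hv
    simp only [LinearEquiv.conj_apply_apply, LinearEquiv.symm_apply_apply,
      LinearMap.comp_apply, LinearMap.inl_apply, LinearMap.snd_apply]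
    refine koszulPair_mem_homog _ _ _ _ _ ?_ ((K.homog _).zero_mem)
    simpa using hg

end koszulPair

/-! ### Cohomology after adding one difference to a Koszul complex. -/

namespace CohomologyBasis

variable {K : FreeBicomplex n} {φ : Fin n → Fin n}

/-- The kernel of `rename φ` is generated by differences within classes. Each is null-homotopic, so
it sends cocycles to coboundaries, and this property passes to the generated ideal. -/
theorem exists_smul_eq_hor (B : CohomologyBasis K φ) (hφ : ∀ v, φ (φ v) = φ v) {e : PolyRing n}
    (he : MvPolynomial.rename φ e = 0) {x : K.ι → PolyRing n} (hx : K.hor.mulVecLin x = 0) :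
    ∃ y, e • x = K.hor.mulVecLin y := by
  have hmem := mem_span_of_rename_eq_zero hφ he
  clear he
  induction hmem using Submodule.span_induction with
  | mem p hp =>
    obtain ⟨i, j, hij, rfl⟩ := hp
    obtain ⟨h, h1, -⟩ := B.nullHomotopic i j hij
    exact ⟨h x, by rw [← h1, hx, map_zero, add_zero]⟩
  | zero => exact ⟨0, by rw [zero_smul, map_zero]⟩
  | add p q _ _ hp hq =>
    obtain ⟨y, hy⟩ := hp
    obtain ⟨y', hy'⟩ := hq
    exact ⟨y + y', by rw [add_smul, hy, hy', map_add]⟩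
  | smul c p _ hp =>
    obtain ⟨y, hy⟩ := hp
    exact ⟨c • y, by rw [smul_assoc, hy, map_smul]⟩

theorem exists_sum_smul_eq_hor (B : CohomologyBasis K φ) (hφ : ∀ v, φ (φ v) = φ v)
    {c : B.index → PolyRing n} (hc : ∀ z, MvPolynomial.rename φ (c z) = 0) :
    ∃ y, ∑ z, c z • B.elt z = K.hor.mulVecLin y := by
  choose y hy using fun z => B.exists_smul_eq_hor hφ (hc z) (B.hor_elt z)
  exact ⟨∑ z, y z, by rw [map_sum]; exact Finset.sum_congr rfl fun z _ => hy z⟩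

/-- The generating function of the bidegrees of a basis. -/
def series (B : CohomologyBasis K φ) : PowerSeries ℤ[T;T⁻¹] :=
  ∑ z, PowerSeries.C (LaurentPolynomial.T (B.tdeg z)) * PowerSeries.X ^ B.qdeg z

/-- The cohomology of `0 → R → 0`. -/
def unit (n : ℕ) : CohomologyBasis (FreeBicomplex.unit n) id where
  index := Unit
  elt _ _ := 1
  tdeg _ := 0
  qdeg _ := 0
  elt_mem _ i _ := ⟨rfl, 0, MvPolynomial.isHomogeneous_one _ _, rfl⟩
  hor_elt _ := Matrix.zero_mulVec (m := Unit) (fun _ : Unit => (1 : PolyRing n))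
  span f _ := by
    refine ⟨fun _ => f (), 0, ?_⟩
    rw [map_zero, add_zero, Fintype.sum_unique]
    exact funext fun x => (mul_one (f x)).symm
  indep c u h z := by
    have hu : (FreeBicomplex.unit n).hor.mulVecLin u = 0 := Matrix.zero_mulVec (m := Unit) u
    rw [hu, Fintype.sum_unique] at h
    have h1 : c z * 1 = 0 := congrFun h ()
    rw [← mul_one (c z), h1, map_zero]
  nullHomotopic i j h := by
    obtain rfl : i = j := h
    exact NullHomotopic.refl _ _

theorem series_unit : (unit n).series = 1 := by
  change ∑ z : Unit, PowerSeries.C (LaurentPolynomial.T 0) * PowerSeries.X ^ 0 = 1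
  simp

theorem nullHomotopic_uniteClasses (B : CohomologyBasis K φ) (i j a b : Fin n)
    (h : uniteClasses φ i j a = uniteClasses φ i j b) :
    ((koszulFactor i j).tensor K).NullHomotopic a b := by
  have key : ∀ a b, φ a = φ b → ((koszulFactor i j).tensor K).NullHomotopic a b :=
    fun a b hab => (B.nullHomotopic a b hab).koszulPair i j
  have hij := nullHomotopic_koszulFactor i j K
  rcases (uniteClasses_eq_iff a b).1 h with h | ⟨h1, h2⟩ | ⟨h1, h2⟩ | ⟨h1, h2⟩
  · exact key a b h
  · exact (key a i h1).trans (hij.trans (key j b h2.symm))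
  · exact (key a j h1).trans (hij.symm.trans (key i b h2.symm))
  · exact key a b (h1.trans h2.symm)

/-- The cohomology of the tensor product with the Koszul complex of `x_i - x_j`, if `i` and `j` lie
in different classes. -/
def koszulOfNe (B : CohomologyBasis K φ) (hφ : ∀ v, φ (φ v) = φ v) {i j : Fin n}
    (hij : φ i ≠ φ j) :
    CohomologyBasis ((koszulFactor i j).tensor K) (uniteClasses φ i j) where
  index := B.index
  elt z := koszulPair i j K (0, B.elt z)
  tdeg := B.tdeg
  qdeg := B.qdeg
  elt_mem z := koszulPair_mem_homog _ _ _ _ _ ((K.homog _).zero_mem) (B.elt_mem z)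
  hor_elt z := by
    rw [hor_koszulPair, B.hor_elt, smul_zero, map_zero, neg_zero, add_zero]
    exact map_zero _
  span v hv := by
    obtain ⟨⟨f, g⟩, rfl⟩ := (koszulPair i j K).surjective v
    rw [hor_koszulPair, LinearEquiv.map_eq_zero_iff, Prod.mk_eq_zero, neg_eq_zero] at hv
    obtain ⟨hf, hg⟩ := hv
    obtain ⟨c, u, hcu⟩ := B.span f hf
    -- The cocycle condition makes `(x_i - x_j) f` a coboundary. Since `x_{φ i} - x_{φ j}` is
    -- nonzero in a domain, it can be cancelled from the relations: the difference is regular on the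
    -- cohomology, and `f` is itself a coboundary.
    have hc : ∀ z, MvPolynomial.rename φ (c z) = 0 := by
      intro z
      have h1 := B.indep (fun z => (MvPolynomial.X i - MvPolynomial.X j) * c z)
        (-((MvPolynomial.X i - MvPolynomial.X j : PolyRing n) • u) - g) (by
          simp only [mul_smul, ← Finset.smul_sum]
          rw [hcu, smul_add] at hg
          rw [map_sub, map_neg, map_smul, ← sub_eq_zero, ← hg]
          abel) z
      rw [map_mul, mul_eq_zero] at h1
      refine h1.resolve_left fun h2 => hij ?_
      rw [map_sub, MvPolynomial.rename_X, MvPolynomial.rename_X, sub_eq_zero] at h2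
      exact MvPolynomial.X_injective h2
    obtain ⟨y, hy⟩ := B.exists_sum_smul_eq_hor hφ hc
    have hfu : f = K.hor.mulVecLin (y + u) := by rw [hcu, hy, map_add]
    -- Subtracting the boundary of `(-(y + u), 0)` leaves a cocycle with left component zero, to
    -- which the old basis applies.
    obtain ⟨c', w, hcw⟩ := B.span
      (g + (MvPolynomial.X i - MvPolynomial.X j : PolyRing n) • (y + u)) (by
        rw [map_add, map_smul, ← hfu, add_comm, hg])
    refine ⟨c', koszulPair i j K (-(y + u), w), ?_⟩
    rw [sum_smul_koszulPair, hor_koszulPair, ← map_add, Prod.mk_add_mk, ← add_assoc]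
    simp only [smul_zero, Finset.sum_const_zero]
    congr 2
    · rw [zero_add, map_neg, neg_neg, hfu]
    · rw [← sub_eq_iff_eq_add'] at hcw
      rw [smul_neg, add_right_comm, ← sub_eq_add_neg, eq_sub_iff_add_eq]
      exact eq_add_of_sub_eq' hcw
  indep c v h z := by
    obtain ⟨⟨u, w⟩, rfl⟩ := (koszulPair i j K).surjective v
    rw [sum_smul_koszulPair, hor_koszulPair, EmbeddingLike.apply_eq_iff_eq, Prod.mk.injEq] at h
    simp only [smul_zero, Finset.sum_const_zero, zero_eq_neg] at h
    obtain ⟨hu, hw⟩ := h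
    obtain ⟨e, y, hey⟩ := B.span u hu
    -- Expanding the cocycle `u` in the old basis shows that each `c z` equals a multiple of `x_i -
    -- x_j` modulo the kernel of `rename φ`.
    have h1 := B.indep (fun z => c z - (MvPolynomial.X i - MvPolynomial.X j) * e z)
      ((MvPolynomial.X i - MvPolynomial.X j : PolyRing n) • y + w) (by
        simp only [sub_smul _ (_ * _), mul_smul, Finset.sum_sub_distrib, ← Finset.smul_sum]
        rw [hw, map_add, map_smul, hey, smul_add]
        abel) z
    -- The new renaming factors through the old one and identifies `x_i` with `x_j`, so the multiple
    -- of `x_i - x_j` disappears.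
    have h2 : ∀ p : PolyRing n, MvPolynomial.rename (uniteClasses φ i j) p =
        MvPolynomial.rename (fun v => if v = φ j then φ i else v) (MvPolynomial.rename φ p) := by
      intro p
      rw [MvPolynomial.rename_rename]
      rfl
    have h3 := (h2 _).trans (congrArg _ h1)
    rw [map_zero, map_sub, map_mul, map_sub, MvPolynomial.rename_X, MvPolynomial.rename_X,
      uniteClasses_ends, sub_self, zero_mul, sub_zero] at h3
    exact h3
  nullHomotopic := B.nullHomotopic_uniteClasses i j

/-- For a cocycle `s` the pair `(s, -h s)` is a cocycle, since the homotopy gives `(x_i - x_j) s = d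
(h s)`. Removing it and the boundary of `(-u, 0)`, where `f = s + d u`, leaves a cocycle with left
component zero. -/
theorem span_koszul_of_eq (B : CohomologyBasis K φ) {i j : Fin n}
    {h : (K.ι → PolyRing n) →ₗ[PolyRing n] (K.ι → PolyRing n)}
    (h1 : ∀ v, K.hor.mulVecLin (h v) + h (K.hor.mulVecLin v) =
      (MvPolynomial.X i - MvPolynomial.X j : PolyRing n) • v)
    {v : ((koszulFactor i j).tensor K).ι → PolyRing n}
    (hv : ((koszulFactor i j).tensor K).hor.mulVecLin v = 0) :
    ∃ (c : B.index ⊕ B.index → PolyRing n) (u : ((koszulFactor i j).tensor K).ι → PolyRing n),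
      v = ∑ z, c z • Sum.elim (fun z => koszulPair i j K (0, B.elt z))
        (fun z => koszulPair i j K (B.elt z, -h (B.elt z))) z +
          ((koszulFactor i j).tensor K).hor.mulVecLin u := by
  obtain ⟨⟨f, g⟩, rfl⟩ := (koszulPair i j K).surjective v
  rw [hor_koszulPair, LinearEquiv.map_eq_zero_iff, Prod.mk_eq_zero, neg_eq_zero] at hv
  obtain ⟨hf, hg⟩ := hv
  obtain ⟨c, u, hcu⟩ := B.span f hf
  set s := ∑ z, c z • B.elt z with hs
  have hds : K.hor.mulVecLin s = 0 := by
    rw [hs, map_sum]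
    exact Finset.sum_eq_zero fun z _ => by rw [map_smul, B.hor_elt, smul_zero]
  obtain ⟨c', w, hcw⟩ := B.span
    (g + h s + (MvPolynomial.X i - MvPolynomial.X j : PolyRing n) • u) (by
      have h3 := h1 s
      rw [hds, map_zero, add_zero] at h3
      rw [hcu, smul_add] at hg
      rw [map_add, map_add, map_smul, h3, ← hg]
      abel)
  refine ⟨Sum.elim c' c, koszulPair i j K (-u, w), ?_⟩
  simp only [Fintype.sum_sum_type, Sum.elim_inl, Sum.elim_inr]
  rw [sum_smul_koszulPair, sum_smul_koszulPair, hor_koszulPair, ← map_add, ← map_add,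
    Prod.mk_add_mk, Prod.mk_add_mk]
  simp only [smul_zero, Finset.sum_const_zero, smul_neg, Finset.sum_neg_distrib, ← map_smul,
    ← map_sum]
  congr 2
  · rw [zero_add, map_neg, neg_neg, ← hs, hcu]
  · rw [← hs, ← sub_eq_zero]
    rw [← sub_eq_zero] at hcw
    rw [← hcw]
    abel

/-- The left components give a relation with primitive `-u`, which settles the right half of the
coefficients. Substituted into the right components, the homotopy identity turns `(x_i - x_j) u - h
(d u)` into `d (h u)`, leaving a relation among the old basis elements. -/
theorem indep_koszul_of_eq (B : CohomologyBasis K φ) {i j : Fin n}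
    {h : (K.ι → PolyRing n) →ₗ[PolyRing n] (K.ι → PolyRing n)}
    (h1 : ∀ v, K.hor.mulVecLin (h v) + h (K.hor.mulVecLin v) =
      (MvPolynomial.X i - MvPolynomial.X j : PolyRing n) • v)
    (c : B.index ⊕ B.index → PolyRing n) (v : ((koszulFactor i j).tensor K).ι → PolyRing n)
    (hv : ∑ z, c z • Sum.elim (fun z => koszulPair i j K (0, B.elt z))
      (fun z => koszulPair i j K (B.elt z, -h (B.elt z))) z =
        ((koszulFactor i j).tensor K).hor.mulVecLin v) (z : B.index ⊕ B.index) :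
    MvPolynomial.rename φ (c z) = 0 := by
  obtain ⟨⟨u, w⟩, rfl⟩ := (koszulPair i j K).surjective v
  simp only [Fintype.sum_sum_type, Sum.elim_inl, Sum.elim_inr] at hv
  rw [sum_smul_koszulPair, sum_smul_koszulPair, hor_koszulPair, ← map_add,
    EmbeddingLike.apply_eq_iff_eq, Prod.mk_add_mk, Prod.mk.injEq] at hv
  simp only [smul_zero, Finset.sum_const_zero, smul_neg, Finset.sum_neg_distrib, ← map_smul,
    ← map_sum, zero_add] at hv
  obtain ⟨hu, hw⟩ := hv
  rw [← map_neg] at hu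
  have hr := B.indep _ _ hu
  rw [hu, map_neg, map_neg, neg_neg, ← h1 u] at hw
  have hl := B.indep (fun z => c (Sum.inl z)) (h u + w) (by
    rw [map_add, ← sub_eq_zero]
    rw [← sub_eq_zero] at hw
    rw [← hw]
    abel)
  rcases z with z | z
  · exact hl z
  · exact hr z

theorem sum_elim_series {ζ : Type} [Fintype ζ] (t : ζ → ℤ) (q : ζ → ℕ) :
    ∑ z, (PowerSeries.C (LaurentPolynomial.T (Sum.elim t (fun z => t z - 1) z)) *
        PowerSeries.X ^ Sum.elim q (fun z => q z + 1) z : PowerSeries ℤ[T;T⁻¹]) =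
      onePlus * ∑ z, PowerSeries.C (LaurentPolynomial.T (t z)) * PowerSeries.X ^ q z := by
  rw [Fintype.sum_sum_type, onePlus, add_mul, one_mul, Finset.mul_sum]
  refine congrArg₂ _ rfl (Finset.sum_congr rfl fun z _ => ?_)
  rw [Sum.elim_inr, Sum.elim_inr, sub_eq_neg_add, LaurentPolynomial.T_add, map_mul, pow_succ',
    mul_mul_mul_comm]

/-- Each old element `e` yields `(0, e)` of the same bidegree and `(e, -h e)` of bidegree shifted by
`(-1, 1)`, hence the factor `1 + t⁻¹ q`. The classes do not change. -/
theorem exists_koszul_of_eq (B : CohomologyBasis K φ) {i j : Fin n} (hij : φ i = φ j) :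
    ∃ B' : CohomologyBasis ((koszulFactor i j).tensor K) (uniteClasses φ i j),
      B'.series = onePlus * B.series := by
  obtain ⟨h, h1, h2⟩ := B.nullHomotopic i j hij
  refine ⟨{
    index := B.index ⊕ B.index
    elt := Sum.elim (fun z => koszulPair i j K (0, B.elt z))
      (fun z => koszulPair i j K (B.elt z, -h (B.elt z)))
    tdeg := Sum.elim B.tdeg fun z => B.tdeg z - 1
    qdeg := Sum.elim B.qdeg fun z => B.qdeg z + 1
    elt_mem := by
      rintro (z | z)
      · exact koszulPair_mem_homog _ _ _ _ _ ((K.homog _).zero_mem) (B.elt_mem z)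
      · refine koszulPair_mem_homog _ _ _ _ _ ?_ ((K.homog _).neg_mem ?_)
        · simpa using B.elt_mem z
        · simp only [Sum.elim_inr, Nat.cast_add, Nat.cast_one]
          exact h2 _ _ (B.elt_mem z)
    hor_elt := by
      rintro (z | z)
      · rw [Sum.elim_inl, hor_koszulPair, B.hor_elt, smul_zero, map_zero, neg_zero, add_zero]
        exact map_zero _
      · have h3 := h1 (B.elt z)
        rw [B.hor_elt, map_zero, add_zero] at h3
        rw [Sum.elim_inr, hor_koszulPair, B.hor_elt, neg_zero, map_neg, ← h3, add_neg_cancel]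
        exact map_zero _
    span := fun v hv => B.span_koszul_of_eq h1 hv
    indep := fun c v hv z => by
      rw [uniteClasses_of_eq hij]
      exact B.indep_koszul_of_eq h1 c v hv z
    nullHomotopic := B.nullHomotopic_uniteClasses i j }, ?_⟩
  exact sum_elim_series B.tdeg B.qdeg

end CohomologyBasis

end FreeBicomplex

/-! ### Equivalence relations generated by lists of pairs -/

/-- Representatives of the classes of the equivalence relation generated by a list of pairs. -/
def classRepr {V : Type*} [DecidableEq V] : List (V × V) → V → V
  | [] => id
  | p :: P => uniteClasses (classRepr P) p.1 p.2

/-- The number of pairs in a list whose ends are already related by the later pairs. -/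
def cycleRank {V : Type*} [DecidableEq V] : List (V × V) → ℕ
  | [] => 0
  | p :: P => if classRepr P p.1 = classRepr P p.2 then cycleRank P + 1 else cycleRank P

theorem classRepr_idem {V : Type*} [DecidableEq V] (P : List (V × V)) (v : V) :
    classRepr P (classRepr P v) = classRepr P v := by
  induction P generalizing v with
  | nil => rfl
  | cons p P ih => exact uniteClasses_idem ih v

/-- Each pair either merges two classes, lowering the number of classes by one, or closes a cycle,
raising the cycle rank by one. -/
theorem card_image_classRepr {V : Type*} [DecidableEq V] [Fintype V] (P : List (V × V)) :
    (Finset.univ.image (classRepr P)).card + P.length = Fintype.card V + cycleRank P := by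
  induction P with
  | nil => simp [classRepr, cycleRank]
  | cons p P ih =>
    rw [classRepr, cycleRank, List.length_cons]
    split_ifs with h
    · rw [uniteClasses_of_eq h]
      omega
    · have h1 : Finset.univ.image (uniteClasses (classRepr P) p.1 p.2) =
          (Finset.univ.image (classRepr P)).erase (classRepr P p.2) := by
        ext x
        simp only [Finset.mem_image, Finset.mem_univ, true_and, Finset.mem_erase, uniteClasses]
        constructor
        · rintro ⟨v, rfl⟩
          split_ifs with hv
          · exact ⟨h, _, rfl⟩
          · exact ⟨hv, _, rfl⟩
        · rintro ⟨hx, v, rfl⟩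
          exact ⟨v, if_neg hx⟩
      have h2 := Finset.card_erase_add_one
        (Finset.mem_image_of_mem (classRepr P) (Finset.mem_univ p.2))
      rw [h1]
      omega

theorem classRepr_eq_iff {V : Type*} [DecidableEq V] (P : List (V × V)) (x y : V) :
    classRepr P x = classRepr P y ↔ Relation.EqvGen (fun u v => (u, v) ∈ P) x y := by
  constructor
  · induction P generalizing x y with
    | nil =>
      rintro rfl
      exact Relation.EqvGen.refl _
    | cons p P ih =>
      have mono : ∀ u v, classRepr P u = classRepr P v →
          Relation.EqvGen (fun u v => (u, v) ∈ p :: P) u v :=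
        fun u v h => (ih u v h).mono fun _ _ h => List.mem_cons_of_mem _ h
      have hp : Relation.EqvGen (fun u v => (u, v) ∈ p :: P) p.1 p.2 :=
        Relation.EqvGen.rel _ _ List.mem_cons_self
      intro h
      rcases (uniteClasses_eq_iff x y).1 h with h | ⟨h1, h2⟩ | ⟨h1, h2⟩ | ⟨h1, h2⟩
      · exact mono x y h
      · exact (mono x _ h1).trans _ _ _ (hp.trans _ _ _ (mono _ y h2.symm))
      · exact (mono x _ h1).trans _ _ _ ((hp.symm _ _).trans _ _ _ (mono _ y h2.symm))
      · exact mono x y (h1.trans h2.symm)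
  · intro h
    induction h with
    | rel x y h =>
      induction P with
      | nil => simp at h
      | cons p P ih =>
        rcases List.mem_cons.1 h with rfl | h
        · exact uniteClasses_ends
        · exact (uniteClasses_eq_iff x y).2 (Or.inl (ih h))
    | refl x => rfl
    | symm x y _ ih => exact ih.symm
    | trans x y z _ _ ih ih' => exact ih.trans ih'

theorem card_image_classRepr_eq_card_quot {V : Type*} [DecidableEq V] [Fintype V]
    (P : List (V × V)) :
    (Finset.univ.image (classRepr P)).card = Nat.card (Quot fun u v : V => (u, v) ∈ P) := by
  rw [← Nat.card_eq_finsetCard]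
  symm
  refine Nat.card_congr (Equiv.ofBijective (Quot.lift (fun v =>
    (⟨classRepr P v, Finset.mem_image_of_mem _ (Finset.mem_univ v)⟩ :
      Finset.univ.image (classRepr P))) fun u v h => Subtype.ext
        ((classRepr_eq_iff P u v).2 (Relation.EqvGen.rel _ _ h))) ⟨?_, ?_⟩)
  · rintro ⟨u⟩ ⟨v⟩ h
    exact Quot.eqvGen_sound ((classRepr_eq_iff P u v).1 (congrArg Subtype.val h))
  · rintro ⟨_, hx⟩
    obtain ⟨v, -, rfl⟩ := Finset.mem_image.1 hx
    exact ⟨Quot.mk _ v, rfl⟩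

/-! ### The Poincaré series of Koszul complexes -/

theorem coeff_geomSeries (d : ℕ) : PowerSeries.coeff d geomSeries = 1 := by
  have h : geomSeries = PowerSeries.mk 1 := by
    have h1 := PowerSeries.mk_one_mul_one_sub_eq_one (S := ℤ[T;T⁻¹])
    calc geomSeries = PowerSeries.mk 1 * (1 - PowerSeries.X) * geomSeries := by rw [h1, one_mul]
      _ = PowerSeries.mk 1 * ((1 - PowerSeries.X) * geomSeries) := mul_assoc _ _ _
      _ = PowerSeries.mk 1 := by rw [one_sub_mul_geomSeries, mul_one]
  rw [h, PowerSeries.coeff_mk, Pi.one_apply]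

/-- Both sides count the monomials of degree `d` in the variables indexed by `s`, so this is the
Hilbert series of a polynomial ring. -/
theorem coeff_geomSeries_pow {V : Type*} [DecidableEq V] (s : Finset V) (d : ℕ) :
    PowerSeries.coeff d (geomSeries ^ s.card) = ((s.finsuppAntidiag d).card : ℤ[T;T⁻¹]) := by
  rw [← Finset.prod_const, PowerSeries.coeff_prod]
  simp [coeff_geomSeries]

/-- The coefficient of `t ^ a * q ^ b`. -/
def seriesCoeff (S : PowerSeries ℤ[T;T⁻¹]) (a b : ℤ) : ℤ :=
  ((S : LaurentSeries ℤ[T;T⁻¹]).coeff b).coeff a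

theorem seriesCoeff_of_neg (S : PowerSeries ℤ[T;T⁻¹]) (a : ℤ) {b : ℤ} (hb : b < 0) :
    seriesCoeff S a b = 0 := by
  rw [seriesCoeff, PowerSeries.coeff_coe, if_pos hb]
  rfl

theorem seriesCoeff_natCast (S : PowerSeries ℤ[T;T⁻¹]) (a : ℤ) (b : ℕ) :
    seriesCoeff S a b = (PowerSeries.coeff b S).coeff a := by
  rw [seriesCoeff, PowerSeries.coeff_coe, if_neg (by omega), Int.natAbs_natCast]

theorem seriesCoeff_sub (S S' : PowerSeries ℤ[T;T⁻¹]) (a b : ℤ) :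
    seriesCoeff (S - S') a b = seriesCoeff S a b - seriesCoeff S' a b := by
  rw [seriesCoeff, PowerSeries.coe_sub]
  rfl

theorem seriesCoeff_X_mul (S : PowerSeries ℤ[T;T⁻¹]) (a b : ℤ) :
    seriesCoeff (PowerSeries.X * S) a b = seriesCoeff S a (b - 1) := by
  rcases lt_or_ge b 0 with hb | hb
  · rw [seriesCoeff_of_neg _ _ hb, seriesCoeff_of_neg _ _ (by omega)]
  · lift b to ℕ using hb
    rw [seriesCoeff_natCast]
    cases b with
    | zero =>
      rw [seriesCoeff_of_neg _ _ (by simp), PowerSeries.coeff_zero_X_mul]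
      rfl
    | succ b =>
      rw [PowerSeries.coeff_succ_X_mul, ← seriesCoeff_natCast]
      congr 1
      push_cast
      ring

theorem seriesCoeff_sum {κ : Type} (s : Finset κ) (S : κ → PowerSeries ℤ[T;T⁻¹]) (a b : ℤ) :
    seriesCoeff (∑ z ∈ s, S z) a b = ∑ z ∈ s, seriesCoeff (S z) a b := by
  classical
  induction s using Finset.induction_on with
  | empty =>
    rw [Finset.sum_empty, Finset.sum_empty, ← sub_self (0 : PowerSeries ℤ[T;T⁻¹]),
      seriesCoeff_sub, sub_self]
  | insert z s hz ih =>
    rw [Finset.sum_insert hz, Finset.sum_insert hz, ← ih, eq_comm, ← eq_sub_iff_add_eq,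
      ← seriesCoeff_sub, add_sub_cancel_right]

theorem coeff_T_mul_natCast (t a : ℤ) (k : ℕ) :
    (LaurentPolynomial.T t * (k : ℤ[T;T⁻¹])).coeff a = if t = a then (k : ℤ) else 0 := by
  rw [← map_natCast LaurentPolynomial.C, mul_comm, ← LaurentPolynomial.single_eq_C_mul_T,
    AddMonoidAlgebra.coeff_single, Finsupp.single_apply]

theorem seriesCoeff_monomial_mul_geomSeries {V : Type*} [DecidableEq V] (s : Finset V) (t : ℤ)
    (q : ℕ) (a b : ℤ) :
    seriesCoeff (PowerSeries.C (LaurentPolynomial.T t) * PowerSeries.X ^ q *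
        geomSeries ^ s.card) a b =
      if t = a ∧ (q : ℤ) ≤ b then ((s.finsuppAntidiag (b - q).toNat).card : ℤ) else 0 := by
  rcases lt_or_ge b 0 with hb | hb
  · rw [seriesCoeff_of_neg _ _ hb, if_neg (by omega)]
  · lift b to ℕ using hb
    rw [seriesCoeff_natCast, mul_assoc, PowerSeries.coeff_C_mul, PowerSeries.coeff_X_pow_mul']
    split_ifs with h1 h2 h2
    · rw [coeff_geomSeries_pow, coeff_T_mul_natCast, if_pos h2.1,
        show ((b : ℤ) - q).toNat = b - q by omega]
    · rw [coeff_geomSeries_pow, coeff_T_mul_natCast, if_neg fun h => h2 ⟨h, by omega⟩]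
    · exact absurd h2.2 (by omega)
    · rw [mul_zero]
      rfl

namespace FreeBicomplex

variable {n : ℕ}

/-- Polynomials in the variables of class representatives are normal forms modulo the kernel of
`rename φ`: idempotence of `φ` makes the renaming fix them. -/
theorem rename_eq_self {φ : Fin n → Fin n} (hφ : ∀ v, φ (φ v) = φ v) {d : ℕ} {p : PolyRing n}
    (hp : p ∈ MvPolynomial.restrictSupport ℚ
      (((Finset.univ.image φ).finsuppAntidiag d : Finset (Fin n →₀ ℕ)) : Set (Fin n →₀ ℕ))) :
    MvPolynomial.rename φ p = p := by
  refine MvPolynomial.hom_congr_vars (f₁ := (MvPolynomial.rename φ : PolyRing n →ₐ[ℚ] PolyRing n).toRingHom)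
    (f₂ := RingHom.id _) ?_ ?_ rfl
  · ext x
    simp
  · intro i hi _
    obtain ⟨m, hm, him⟩ := (MvPolynomial.mem_vars_iff_mem_support i).1 hi
    have h2 := (Finset.mem_finsuppAntidiag.1 ((MvPolynomial.mem_restrictSupport_iff ℚ).1 hp hm)).2 him
    obtain ⟨v, -, rfl⟩ := Finset.mem_image.1 h2
    simp [hφ]

theorem mem_finsuppAntidiag_iff {s : Finset (Fin n)} {d : ℕ} {m : Fin n →₀ ℕ} :
    m ∈ s.finsuppAntidiag d ↔ m.degree = d ∧ m.support ⊆ s := by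
  rw [Finset.mem_finsuppAntidiag, and_congr_left_iff]
  intro h
  rw [Finsupp.degree_apply, Finset.sum_subset h fun i _ hi => Finsupp.notMem_support_iff.1 hi]

theorem weight_one_apply (m : Fin n →₀ ℕ) : Finsupp.weight (1 : Fin n → ℕ) m = m.degree :=
  (DFunLike.congr_fun Finsupp.degree_eq_weight_one m).symm

theorem isHomogeneous_of_mem_restrictSupport {s : Finset (Fin n)} {d : ℕ} {p : PolyRing n}
    (hp : p ∈ MvPolynomial.restrictSupport ℚ
      ((s.finsuppAntidiag d : Finset (Fin n →₀ ℕ)) : Set (Fin n →₀ ℕ))) :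
    p.IsHomogeneous d := by
  intro m hm
  rw [weight_one_apply]
  exact (mem_finsuppAntidiag_iff.1 ((MvPolynomial.mem_restrictSupport_iff ℚ).1 hp
    (MvPolynomial.mem_support_iff.2 hm))).1

theorem rename_mem_restrictSupport (φ : Fin n → Fin n) {d : ℕ} {p : PolyRing n}
    (hp : p.IsHomogeneous d) :
    MvPolynomial.rename φ p ∈ MvPolynomial.restrictSupport ℚ
      (((Finset.univ.image φ).finsuppAntidiag d : Finset (Fin n →₀ ℕ)) : Set (Fin n →₀ ℕ)) := by
  rw [MvPolynomial.mem_restrictSupport_iff]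
  intro m hm
  refine Finset.mem_coe.2 (mem_finsuppAntidiag_iff.2 ⟨?_, fun i hi => ?_⟩)
  · have := hp.rename_isHomogeneous (f := φ) (MvPolynomial.mem_support_iff.1 hm)
    rwa [weight_one_apply] at this
  · obtain ⟨v, -, rfl⟩ := MvPolynomial.mem_vars_rename φ p
      ((MvPolynomial.mem_vars_iff_mem_support i).2 ⟨m, hm, hi⟩)
    exact Finset.mem_image_of_mem _ (Finset.mem_univ v)

namespace CohomologyBasis

variable {K : FreeBicomplex n} {φ : Fin n → Fin n} (B : CohomologyBasis K φ)

/-- The monomials `m` for which `m` times the basis element `z` has bidegree `(a, b)`. -/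
def monomials (a b : ℤ) (z : B.index) : Finset (Fin n →₀ ℕ) :=
  if B.tdeg z = a ∧ (B.qdeg z : ℤ) ≤ b then
    (Finset.univ.image φ).finsuppAntidiag (b - B.qdeg z).toNat else ∅

theorem seriesCoeff_series_mul (a b : ℤ) :
    seriesCoeff (B.series * geomSeries ^ (Finset.univ.image φ).card) a b =
      ∑ z, ((B.monomials a b z).card : ℤ) := by
  rw [series, Finset.sum_mul, seriesCoeff_sum]
  refine Finset.sum_congr rfl fun z _ => ?_
  rw [seriesCoeff_monomial_mul_geomSeries, monomials]
  split_ifs <;> rfl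

theorem smul_elt_mem {a b : ℤ} {z : B.index} {c : PolyRing n}
    (hc : c ∈ MvPolynomial.restrictSupport ℚ (B.monomials a b z : Set (Fin n →₀ ℕ))) :
    c • B.elt z ∈ K.homog (a, b) := by
  intro i hi
  rw [monomials] at hc
  split_ifs at hc with h
  · obtain ⟨ht, d, hd, hq⟩ := B.elt_mem z i (right_ne_zero_of_mul hi)
    exact ⟨ht.trans h.1, _, (isHomogeneous_of_mem_restrictSupport hc).mul hd, by
      push_cast
      dsimp only at hq ⊢
      omega⟩
  · have : c = 0 := by simpa [MvPolynomial.mem_restrictSupport_iff] using hc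
    rw [this, zero_smul] at hi
    exact absurd rfl hi

/-- Linear combinations of the basis elements of total bidegree `(a, b)`. -/
def combination (hrow : ∀ i, K.row i = 0) (a b : ℤ) :
    ((z : B.index) → MvPolynomial.restrictSupport ℚ (B.monomials a b z : Set (Fin n →₀ ℕ))) →ₗ[ℚ]
      K.cocyclesPiece 0 (a, b) where
  toFun c := ⟨∑ z, (c z : PolyRing n) • B.elt z, ⟨fun i hi => absurd (hrow i) hi,
      (K.homog _).sum_mem fun z _ => B.smul_elt_mem (c z).2⟩, by
    change K.hor.mulVecLin _ = 0
    rw [map_sum]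
    exact Finset.sum_eq_zero fun z _ => by rw [map_smul, B.hor_elt, smul_zero]⟩
  map_add' c c' := Subtype.ext <| by
    simp only [Pi.add_apply, Submodule.coe_add, add_smul, Finset.sum_add_distrib]
  map_smul' r c := Subtype.ext <| by
    simp only [Pi.smul_apply, Submodule.coe_smul, smul_assoc, Finset.smul_sum, RingHom.id_apply]

/-- As `B.elt z` is homogeneous, projecting a multiple of it amounts to taking a homogeneous
component of the coefficient, or zero when the bidegrees are incompatible. -/
theorem exists_proj_smul_elt (a b : ℤ) (z : B.index) (c : PolyRing n) :
    ∃ c' : PolyRing n, K.proj (a, b) (c • B.elt z) = c' • B.elt z ∧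
      MvPolynomial.rename φ c' ∈
        MvPolynomial.restrictSupport ℚ (B.monomials a b z : Set (Fin n →₀ ℕ)) := by
  by_cases h : B.tdeg z = a ∧ (B.qdeg z : ℤ) ≤ b
  · refine ⟨MvPolynomial.homogeneousComponent (b - B.qdeg z).toNat c, ?_, ?_⟩
    · ext1 i
      simp only [proj, Pi.smul_apply, smul_eq_mul]
      by_cases hi : B.elt z i = 0
      · simp [hi]
      · obtain ⟨ht, d, hd, hq⟩ := B.elt_mem z i hi
        dsimp only at hq ht
        rw [if_pos ⟨ht.trans h.1, by omega⟩, mul_comm, homogeneousComponent_mul hd,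
          if_pos (by omega), mul_comm,
          show (b - K.qdeg i).toNat - d = (b - B.qdeg z).toNat by omega]
    · rw [monomials, if_pos h]
      exact rename_mem_restrictSupport φ (MvPolynomial.homogeneousComponent_isHomogeneous _ _)
  · refine ⟨0, ?_, by rw [map_zero]; exact zero_mem _⟩
    ext1 i
    simp only [proj, Pi.smul_apply, smul_eq_mul, zero_mul]
    by_cases hi : B.elt z i = 0
    · simp [hi]
    · obtain ⟨ht, d, hd, hq⟩ := B.elt_mem z i hi
      dsimp only at hq ht
      split_ifs with h1
      · rw [mul_comm, homogeneousComponent_mul hd, if_neg]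
        intro h2
        exact h ⟨ht.symm.trans h1.1, by omega⟩
      · rfl

theorem eq_zero_of_rename_eq_zero (hφ : ∀ v, φ (φ v) = φ v) {a b : ℤ} {z : B.index}
    {c : PolyRing n}
    (hc : c ∈ MvPolynomial.restrictSupport ℚ (B.monomials a b z : Set (Fin n →₀ ℕ)))
    (h : MvPolynomial.rename φ c = 0) : c = 0 := by
  rw [monomials] at hc
  split_ifs at hc
  · rw [← rename_eq_self hφ hc, h]
  · simpa [MvPolynomial.mem_restrictSupport_iff] using hc

/-- Every class of bidegree `(a, b)` is a unique combination of basis elements with coefficients in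
normal form, that is, involving only variables of class representatives. Uniqueness comes from
`indep`; existence from projecting an arbitrary expansion and replacing each coefficient by its
renaming. -/
theorem finrank_cohomologyPiece (hφ : ∀ v, φ (φ v) = φ v) (hrow : ∀ i, K.row i = 0) (a b : ℤ) :
    Module.finrank ℚ (K.cohomologyPiece 0 (a, b)) = ∑ z, (B.monomials a b z).card := by
  have hfin : ∀ z, Module.finrank ℚ (MvPolynomial.restrictSupport ℚ
      (B.monomials a b z : Set (Fin n →₀ ℕ))) = (B.monomials a b z).card := by
    intro z
    rw [Module.finrank_eq_card_basis (MvPolynomial.basisRestrictSupport ℚ _)]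
    simp
  have hfree : ∀ z, Module.Finite ℚ (MvPolynomial.restrictSupport ℚ
      (B.monomials a b z : Set (Fin n →₀ ℕ))) := fun z =>
    Module.Finite.of_basis (MvPolynomial.basisRestrictSupport ℚ _)
  rw [← Finset.sum_congr rfl fun z _ => hfin z, ← Module.finrank_pi_fintype]
  refine (LinearEquiv.finrank_eq (LinearEquiv.ofBijective
    (K.classMap 0 (a, b) ∘ₗ B.combination hrow a b) ⟨?_, fun x => ?_⟩)).symm
  · rw [← LinearMap.ker_eq_bot, LinearMap.ker_eq_bot']
    intro c hc
    rw [LinearMap.comp_apply, classMap_eq_zero_iff] at hc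
    obtain ⟨u, -, hu⟩ := hc
    ext1 z
    have h1 := B.indep _ u hu.symm z
    exact Subtype.ext (B.eq_zero_of_rename_eq_zero hφ (c z).2 h1)
  · obtain ⟨⟨f, hf⟩, rfl⟩ := K.classMap_surjective 0 (a, b) x
    obtain ⟨c, u, hcu⟩ := B.span f hf.2
    choose c' hc' hc'' using fun z => B.exists_proj_smul_elt a b z (c z)
    refine ⟨fun z => ⟨MvPolynomial.rename φ (c' z), hc'' z⟩, ?_⟩
    rw [LinearMap.comp_apply, ← sub_eq_zero, ← map_sub, classMap_eq_zero_iff]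
    -- Idempotence puts `rename φ (c' z) - c' z` in the kernel, so passing to normal forms changes
    -- the cocycle by a coboundary.
    obtain ⟨y, hy⟩ := B.exists_sum_smul_eq_hor hφ
      (c := fun z => MvPolynomial.rename φ (c' z) - c' z) fun z => by
        rw [map_sub, MvPolynomial.rename_rename, sub_eq_zero]
        congr 2
        exact funext hφ
    have hf2 : f = ∑ z, c' z • B.elt z + K.hor.mulVecLin (K.proj (a - 1, b) u) := by
      have h3 : K.hor.mulVecLin (K.proj (a - 1, b) u) = K.proj (a, b) (K.hor.mulVecLin u) := by
        have := K.mulVec_proj K.hor_deg (a - 1, b) u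
        rwa [sub_add_cancel] at this
      rw [h3, ← Finset.sum_congr rfl fun z _ => hc' z, ← proj_sum, ← proj_add, ← hcu,
        K.proj_of_mem hf.1.2]
    refine ⟨y - K.proj (a - 1, b) u, fun i hi => absurd (hrow i) hi, ?_⟩
    rw [map_sub, ← hy]
    change _ = ∑ z, MvPolynomial.rename φ (c' z) • B.elt z - f
    rw [hf2]
    simp only [sub_smul, Finset.sum_sub_distrib]
    abel

theorem eulerCoeff_eq (hφ : ∀ v, φ (φ v) = φ v) (hrow : ∀ i, K.row i = 0) (a b : ℤ) :
    K.eulerCoeff a b = seriesCoeff (B.series * geomSeries ^ (Finset.univ.image φ).card) a b := by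
  rw [eulerCoeff, finsum_eq_single _ 0, Int.negOnePow_zero, B.seriesCoeff_series_mul,
    B.finrank_cohomologyPiece hφ hrow]
  · push_cast
    exact one_mul _
  · intro j hj
    rw [K.finrank_eq_zero_of_row fun i => by rw [hrow]; exact hj.symm]
    exact mul_zero _

end CohomologyBasis

/-! ### Koszul complexes of lists of pairs of vertices -/

/-- The Koszul complexes of a list of pairs of vertices. -/
def koszulFactors (P : List (Fin n × Fin n)) : List (FreeBicomplex n) :=
  P.map fun p => koszulFactor p.1 p.2

theorem exists_cohomologyBasis (P : List (Fin n × Fin n)) :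
    ∃ B : CohomologyBasis (tensorList (koszulFactors P)) (classRepr P),
      B.series = onePlus ^ cycleRank P := by
  induction P with
  | nil => exact ⟨CohomologyBasis.unit n, CohomologyBasis.series_unit⟩
  | cons p P ih =>
    obtain ⟨B, hB⟩ := ih
    rw [cycleRank]
    split_ifs with h
    · obtain ⟨B', hB'⟩ := B.exists_koszul_of_eq h
      exact ⟨B', hB'.trans (by rw [hB, pow_succ'])⟩
    · exact ⟨B.koszulOfNe (classRepr_idem P) h, hB⟩

theorem row_koszulFactors (P : List (Fin n × Fin n)) (i : (tensorList (koszulFactors P)).ι) :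
    (tensorList (koszulFactors P)).row i = 0 := by
  induction P with
  | nil => rfl
  | cons p P ih => exact (zero_add _).trans (ih i.2)

theorem eulerCoeff_koszulFactors (P : List (Fin n × Fin n)) (a b : ℤ) :
    (tensorList (koszulFactors P)).eulerCoeff a b =
      seriesCoeff (onePlus ^ cycleRank P *
        geomSeries ^ (Finset.univ.image (classRepr P)).card) a b := by
  obtain ⟨B, hB⟩ := exists_cohomologyBasis P
  rw [B.eulerCoeff_eq (classRepr_idem P) (row_koszulFactors P), hB]

end FreeBicomplex

/-! ### The sum over the sets of edges -/

/-- Related elements need only go to elements of the generated equivalence relation. This absorbs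
the difference between symmetric adjacency and the ordered pairs of a labelling, and the omission of
loops. -/
theorem card_quot_congr {A B : Type*} (e : A ≃ B) {r : A → A → Prop} {r' : B → B → Prop}
    (h : ∀ x y, r x y → Relation.EqvGen r' (e x) (e y))
    (h' : ∀ u v, r' u v → Relation.EqvGen r (e.symm u) (e.symm v)) :
    Nat.card (Quot r) = Nat.card (Quot r') := by
  refine Nat.card_congr
    { toFun := Quot.lift (fun x => Quot.mk _ (e x)) fun x y hxy => Quot.eqvGen_sound (h x y hxy)
      invFun := Quot.lift (fun u => Quot.mk _ (e.symm u))
        fun u v huv => Quot.eqvGen_sound (h' u v huv)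
      left_inv := ?_
      right_inv := ?_ }
  · rintro ⟨x⟩
    exact congrArg (Quot.mk r) (e.symm_apply_apply x)
  · rintro ⟨u⟩
    exact congrArg (Quot.mk r') (e.apply_symm_apply u)

/-- The number of classes of the equivalence relation generated by a list of pairs and by the ends
of a set of edges. -/
def numClasses {V ι : Type*} (f : ι → V × V) (s : Finset ι) (P : List (V × V)) : ℕ :=
  Nat.card (Quot fun u v : V => (u, v) ∈ P ∨ ∃ i ∈ s, f i = (u, v))

section numClasses

variable {V ι : Type*} (f : ι → V × V) (s : Finset ι) (P : List (V × V))

theorem numClasses_empty [Fintype V] [DecidableEq V] :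
    numClasses f ∅ P = (Finset.univ.image (classRepr P)).card := by
  rw [card_image_classRepr_eq_card_quot]
  simp [numClasses]

theorem numClasses_loops (hP : ∀ p ∈ P, p.1 = p.2) :
    numClasses f s P = numClasses f s [] := by
  refine card_quot_congr (Equiv.refl V) (fun x y h => ?_) fun x y h => ?_
  · rcases h with h | h
    · obtain rfl : x = y := hP _ h
      exact Relation.EqvGen.refl _
    · exact Relation.EqvGen.rel _ _ (Or.inr h)
  · exact Relation.EqvGen.rel _ _ (h.imp_left fun h => absurd h List.not_mem_nil)

theorem numClasses_cons_loop (u : V) : numClasses f s ((u, u) :: P) = numClasses f s P := by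
  refine card_quot_congr (Equiv.refl V) (fun x y h => ?_) fun x y h => ?_
  · rcases h with h | h
    · rcases List.mem_cons.1 h with h | h
      · obtain ⟨rfl, rfl⟩ := Prod.mk.inj h
        exact Relation.EqvGen.refl _
      · exact Relation.EqvGen.rel _ _ (Or.inl h)
    · exact Relation.EqvGen.rel _ _ (Or.inr h)
  · exact Relation.EqvGen.rel _ _ (h.imp_left (List.mem_cons_of_mem _))

/-- Moving a chosen edge from the set to the list mirrors the contraction branch of `eulerSeries`.
-/
theorem numClasses_insert [DecidableEq ι] (i : ι) :
    numClasses f (insert i s) P = numClasses f s (f i :: P) := by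
  have : (fun u v : V => (u, v) ∈ P ∨ ∃ k ∈ insert i s, f k = (u, v)) =
      fun u v : V => (u, v) ∈ f i :: P ∨ ∃ k ∈ s, f k = (u, v) := by
    ext u v
    simp only [Finset.exists_mem_insert, List.mem_cons, eq_comm (a := f i)]
    tauto
  rw [numClasses, this, numClasses]

end numClasses

/-- The Euler characteristic of the tensor product of the complexes of a list of edges and of the
Koszul complexes of a list of pairs of vertices. -/
def eulerSeries {V : Type*} [Fintype V] [DecidableEq V] :
    List (V × V) → List (V × V) → PowerSeries ℤ[T;T⁻¹]
  | [], P => onePlus ^ cycleRank P * geomSeries ^ (Finset.univ.image (classRepr P)).card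
  -- Deletion contributes a loop, because row `0` of the edge complex is the Koszul complex of zero.
  -- Both branches thus lengthen `P` by one.
  | e :: E, P => eulerSeries E ((e.1, e.1) :: P) - PowerSeries.X * eulerSeries E (e :: P)

/-- All terms of the expansion end with a list of the same length, so the cycle rank exceeds the
number of classes by the same constant `l.length + P.length - Fintype.card V`. The factor `onePlus ^
Fintype.card V` on the left avoids this subtraction. Indexing edges by `ι` keeps parallel edges
distinct. -/
theorem onePlus_pow_mul_eulerSeries {V ι : Type*} [Fintype V] [DecidableEq V] [DecidableEq ι]
    (f : ι → V × V) (l : List ι) (hl : l.Nodup) (P : List (V × V)) :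
    onePlus ^ Fintype.card V * eulerSeries (l.map f) P =
      onePlus ^ (l.length + P.length) * ∑ s ∈ l.toFinset.powerset,
        (-PowerSeries.X) ^ s.card * (onePlus * geomSeries) ^ numClasses f s P := by
  induction l generalizing P with
  | nil =>
    simp only [List.map_nil, eulerSeries, List.toFinset_nil, Finset.powerset_empty,
      Finset.sum_singleton, Finset.card_empty, pow_zero, one_mul, numClasses_empty,
      List.length_nil, zero_add]
    rw [mul_pow, ← mul_assoc, ← mul_assoc, ← pow_add, ← pow_add, ← card_image_classRepr, add_comm]
  | cons i l ih =>
    obtain ⟨hi, hl⟩ := List.nodup_cons.1 hl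
    rw [List.map_cons, eulerSeries, mul_sub, mul_left_comm, ih hl, ih hl, List.toFinset_cons,
      Finset.sum_powerset_insert (by simpa using hi), List.length_cons, List.length_cons,
      List.length_cons, Nat.add_right_comm l.length 1, add_assoc l.length, mul_left_comm,
      ← mul_sub]
    refine congrArg _ ?_
    rw [sub_eq_add_neg, ← neg_mul, Finset.mul_sum]
    refine congrArg₂ _ ?_ ?_
    · exact Finset.sum_congr rfl fun s _ => by rw [numClasses_cons_loop]
    · refine Finset.sum_congr rfl fun s hs => ?_
      rw [numClasses_insert, Finset.card_insert_of_notMem fun h =>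
        hi (List.mem_toFinset.1 (Finset.mem_powerset.1 hs h)), pow_succ', mul_assoc]

theorem isUnit_onePlus : IsUnit onePlus := by
  rw [PowerSeries.isUnit_iff_constantCoeff]
  simp [onePlus]

/-- With one loop per vertex the factor `onePlus ^ Fintype.card V` appears on both sides and, being
a unit, cancels. Loops add no relations, so they drop out of `numClasses`. -/
theorem eulerSeries_loops {V ι : Type*} [Fintype V] [DecidableEq V] [DecidableEq ι]
    (f : ι → V × V) (l : List ι) (hl : l.Nodup) (P : List (V × V)) (hP : ∀ p ∈ P, p.1 = p.2)
    (hlen : P.length = Fintype.card V) :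
    eulerSeries (l.map f) P = onePlus ^ l.length * ∑ s ∈ l.toFinset.powerset,
        (-PowerSeries.X) ^ s.card * (onePlus * geomSeries) ^ numClasses f s [] := by
  refine (isUnit_onePlus.pow (Fintype.card V)).mul_left_cancel ?_
  rw [onePlus_pow_mul_eulerSeries f l hl, hlen, pow_add, mul_comm (onePlus ^ l.length), mul_assoc]
  simp only [numClasses_loops f _ P hP]

namespace FreeBicomplex

variable {n : ℕ}

/-- The complexes of a list of edges. -/
def edgeFactors (E : List (Fin n × Fin n)) : List (FreeBicomplex n) :=
  E.map fun p => edgeFactor p.1 p.2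

/-- The Koszul factor produced by an edge is moved past the remaining edges to join the list of
pairs, which gives the recursion of `eulerSeries`. -/
theorem eulerCoeff_koszulFactor_tensor (E P : List (Fin n × Fin n)) (p : Fin n × Fin n)
    (a b : ℤ) :
    ((koszulFactor p.1 p.2).tensor (tensorList (edgeFactors E ++ koszulFactors P))).eulerCoeff a b =
      (tensorList (edgeFactors E ++ koszulFactors (p :: P))).eulerCoeff a b := by
  obtain ⟨f⟩ := SignedIso.tensorList_perm (List.perm_middle (a := koszulFactor p.1 p.2)
    (l₁ := edgeFactors E) (l₂ := koszulFactors P)).symm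
  exact f.eulerCoeff_eq a b

theorem eulerCoeff_tensorList (E P : List (Fin n × Fin n)) (a b : ℤ) :
    (tensorList (edgeFactors E ++ koszulFactors P)).eulerCoeff a b =
      seriesCoeff (eulerSeries E P) a b := by
  induction E generalizing P b with
  | nil => exact eulerCoeff_koszulFactors P a b
  | cons e E ih =>
    have h := eulerCoeff_edge e.1 e.2 (tensorList (edgeFactors E ++ koszulFactors P)) a b
    rw [eulerCoeff_koszulFactor_tensor E P e, eulerCoeff_koszulFactor_tensor E P (e.1, e.1),
      ih, ih, ← seriesCoeff_X_mul, ← seriesCoeff_sub] at h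
    exact h

theorem row_edgeFactors (E P : List (Fin n × Fin n))
    (i : (tensorList (edgeFactors E ++ koszulFactors P)).ι) :
    -(E.length : ℤ) ≤ (tensorList (edgeFactors E ++ koszulFactors P)).row i ∧
      (tensorList (edgeFactors E ++ koszulFactors P)).row i ≤ 0 := by
  induction E with
  | nil =>
    have := row_koszulFactors P i
    exact ⟨this.ge, this.le⟩
  | cons e E ih =>
    obtain ⟨⟨c, l⟩, k⟩ := i
    obtain ⟨h1, h2⟩ := ih k
    have h3 : (tensorList (edgeFactors (e :: E) ++ koszulFactors P)).row ((c, l), k) =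
      (if c then -1 else 0) + (tensorList (edgeFactors E ++ koszulFactors P)).row k := rfl
    rw [List.length_cons]
    push_cast
    constructor
    · refine le_trans ?_ h3.ge
      split_ifs <;> omega
    · refine h3.le.trans ?_
      split_ifs <;> omega

end FreeBicomplex

/-! ### Comparison with the dichromatic polynomial of the graph. -/

namespace Labelling

variable {α β : Type*} {G : Graph α β} {n m : ℕ} (L : Labelling G n m)

/-- The two ends of an edge. -/
def ends (k : Fin m) : Fin n × Fin n := (L.fst k, L.snd k)

theorem bicomplex_eq : L.bicomplex = FreeBicomplex.tensorList
    (FreeBicomplex.edgeFactors ((List.finRange m).map L.ends) ++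
      FreeBicomplex.koszulFactors ((List.finRange n).map fun i => (i, i))) := by
  rw [bicomplex, FreeBicomplex.edgeFactors, FreeBicomplex.koszulFactors, List.map_map,
    List.map_map, List.ofFn_eq_map, List.ofFn_eq_map]
  congr 2
  exact List.map_congr_left fun i _ => (FreeBicomplex.koszulFactor_self i).symm

theorem row_bounds (i : L.bicomplex.ι) :
    -(m : ℤ) ≤ L.bicomplex.row i ∧ L.bicomplex.row i ≤ 0 := by
  revert i
  rw [bicomplex_eq]
  intro i
  simpa using FreeBicomplex.row_edgeFactors ((List.finRange m).map L.ends)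
    ((List.finRange n).map fun i => (i, i)) i

theorem numComponents_restrict (s : Finset (Fin m)) :
    numComponents (G.restrict ((fun k => (L.edge.symm k : β)) '' (s : Set (Fin m)))) =
      numClasses L.ends s [] := by
  refine card_quot_congr (L.vertex : V(G) ≃ Fin n) (fun x y h => ?_) fun u v h => ?_
  · obtain ⟨e, he⟩ := h
    obtain ⟨⟨k, hk, rfl⟩, he⟩ := Eq.mp (Graph.restrict_isLink _ _ _ _ _) he
    have key : Relation.EqvGen (fun u v => (u, v) ∈ ([] : List (Fin n × Fin n)) ∨
        ∃ i ∈ s, L.ends i = (u, v)) (L.fst k) (L.snd k) :=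
      Relation.EqvGen.rel _ _ (Or.inr ⟨k, hk, rfl⟩)
    have hv : ∀ (x : V(G)) (i : Fin n), (x : α) = L.vertex.symm i → L.vertex x = i :=
      fun x i hx => (Equiv.eq_symm_apply _).1 (Subtype.ext hx)
    rcases he.eq_and_eq_or_eq_and_eq (L.isLink k) with ⟨h1, h2⟩ | ⟨h1, h2⟩
    · have h3 := hv x _ h1
      have h4 := hv y _ h2
      rw [h3, h4]
      exact key
    · have h3 := hv x _ h1
      have h4 := hv y _ h2
      rw [h3, h4]
      exact key.symm
  · rcases h with h | ⟨k, hk, h⟩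
    · exact absurd h List.not_mem_nil
    · obtain ⟨rfl, rfl⟩ := Prod.mk.inj h
      exact Relation.EqvGen.rel _ _ ⟨L.edge.symm k, Eq.mpr (Graph.restrict_isLink _ _ _ _ _)
        ⟨⟨k, hk, rfl⟩, L.isLink k⟩⟩

theorem dichromatic_eq : dichromatic G = ∑ s : Finset (Fin m),
    (-1) ^ s.card * MvPolynomial.X 0 ^ s.card * MvPolynomial.X 1 ^ numClasses L.ends s [] := by
  set w : Fin m → β := fun k => (L.edge.symm k : β) with hw
  have hwinj : Function.Injective w := Subtype.val_injective.comp L.edge.symm.injective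
  have hinj : Function.Injective fun s : Finset (Fin m) => w '' (s : Set (Fin m)) :=
    (Set.image_injective.2 hwinj).comp Finset.coe_injective
  have hE : E(G).powerset = (fun s : Finset (Fin m) => w '' (s : Set (Fin m))) ''
      ((Finset.univ : Finset (Finset (Fin m))) : Set (Finset (Fin m))) := by
    ext t
    simp only [Set.mem_powerset_iff, Finset.coe_univ, Set.image_univ, Set.mem_range]
    constructor
    · intro ht
      refine ⟨(w ⁻¹' t).toFinite.toFinset, ?_⟩
      rw [Set.Finite.coe_toFinset, Set.image_preimage_eq_of_subset]
      intro e he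
      exact ⟨L.edge ⟨e, ht he⟩, by simp [hw]⟩
    · rintro ⟨s, rfl⟩ _ ⟨k, -, rfl⟩
      exact (L.edge.symm k).2
  rw [dichromatic, hE, finsum_mem_image hinj.injOn, finsum_mem_coe_finset]
  refine Finset.sum_congr rfl fun s _ => ?_
  rw [Set.ncard_image_of_injective _ hwinj, Set.ncard_coe_finset, L.numComponents_restrict]

theorem ncard_edgeSet (L : Labelling G n m) : E(G).ncard = m := by
  rw [← Nat.card_coe_set_eq, Nat.card_congr L.edge, Nat.card_fin]

theorem reparamDichromatic_eq : reparamDichromatic G =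
    eulerSeries ((List.finRange m).map L.ends) ((List.finRange n).map fun i => (i, i)) := by
  rw [eulerSeries_loops _ _ (List.nodup_finRange m) _ (by simp) (by simp), reparamDichromatic,
    L.ncard_edgeSet, L.dichromatic_eq, List.length_finRange, List.toFinset_finRange,
    Finset.powerset_univ, map_sum]
  refine congrArg _ (Finset.sum_congr rfl fun s _ => ?_)
  simp only [map_mul, map_pow, map_neg, map_one, MvPolynomial.aeval_X, Matrix.cons_val_zero,
    Matrix.cons_val_one]
  rw [← mul_pow, neg_one_mul]

theorem eulerChar_complex (a b : ℤ) :
    eulerChar L.complex a b = seriesCoeff (reparamDichromatic G) a b := by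
  rw [reparamDichromatic_eq L, ← FreeBicomplex.eulerCoeff_tensorList, ← bicomplex_eq]
  -- The terms of the cohomology complex are the row cohomologies by definition, so `eulerChar`
  -- unfolds to `eulerCoeff`.
  rfl

end Labelling

end KoszulGraph

end
theorem theorem3 {α β α' β' : Type*} (G : Graph α β) (n m : ℕ)
    (L : KoszulGraph.Labelling G n m) :
    -- the homotopy class is an invariant: for every isomorphic graph and all choices
    (∀ (G' : Graph α' β') (φ : KoszulGraph.GraphIso G G') (L' : KoszulGraph.Labelling G' n m),
      Nonempty (HomotopyEquiv L.complex
        (((KoszulGraph.BigradedModule.permute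
          (L.vertex.symm.trans (φ.vertexEquiv.trans L'.vertex))).mapHomologicalComplex
            (ComplexShape.up ℤ)).obj L'.complex))) ∧
    -- the complex lives in degrees `-m ≤ j ≤ 0`
    (∀ j : ℤ, (j < -(m : ℤ) ∨ 0 < j) → Subsingleton (L.complex.X j).carrier) ∧
    -- its homogeneous pieces are finite-dimensional
    (∀ (j : ℤ) (p : ℤ × ℤ), FiniteDimensional ℚ ((L.complex.X j).piece p)) ∧
    -- its bigraded Euler characteristic is the reparametrized dichromatic polynomial
    (∀ a b : ℤ, KoszulGraph.eulerChar L.complex a b =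
      ((KoszulGraph.reparamDichromatic G : LaurentSeries ℤ[T;T⁻¹]).coeff b).coeff a) := by
  refine ⟨fun G' φ L' => ?_, fun j hj => ?_, fun j p => ?_, fun a b => L.eulerChar_complex a b⟩
  · obtain ⟨f⟩ := KoszulGraph.Labelling.nonempty_signedIso φ L L'
    exact ⟨HomotopyEquiv.ofIso f.cohomologyComplexIso⟩
  -- Every edge factor contributes `0` or `-1` to the row and every vertex factor `0`, so the other
  -- rows contain no basis elements.
  · refine L.bicomplex.subsingleton_cohomology fun i hi => ?_
    have := L.row_bounds i
    omega
  · exact L.bicomplex.finiteDimensional_cohomologyPiece j p
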